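/- All Hopf algebras are over $\mathbb{C}$, with coproduct $\Delta(x)=\sum x_1\otimes x_2$, counit $\varepsilon$ and antipode $\mathcal{S}$. A *$*$-Hopf algebra* is a Hopf algebra $H$ with a conjugate-linear involution $x\mapsto x^*$ such that $(xy)^*=y^*x^*$ and $\Delta(x^*)=\sum x_1^*\otimes x_2^*$. It is a *compact quantum group* (CQG) if every right $H$-comodule $V$, $v\mapsto\sum v_0\otimes v_1$, admits an inner product (linear in the first variable, conjugate-linear in the second, hermitian and positive definite) that is invariant: $$\sum\langle u_0,v\rangle\,\mathcal{S}(u_1)=\sum\langle u,v_0\rangle\,v_1^*\qquad\text{for all }u,v\in V .$$ Let $H$ be a finite-dimensional $*$-Hopf algebra. The dual Hopf algebra $H^\vee$ (with product $(\alpha\beta)(x)=\sum\alpha(x_1)\beta(x_2)$ and coproduct $\sum\alpha_1(x)\alpha_2(y)=\alpha(xy)$) is a $*$-Hopf algebra with $\alpha^*(x)=\overline{\alpha(\mathcal{S}(x)^*)}$, and so is $(H^\vee)^{\mathrm{cop}}$, which is $H^\vee$ with the opposite coproduct. The *Drinfeld double* $D(H)=(H^\vee)^{\mathrm{cop}}\bowtie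 H$ is the Hopf algebra with underlying coalgebra $(H^\vee)^{\mathrm{cop}}\otimes H$, whose elements $\alpha\otimes x$ are written $\alpha x$, and with product $$(\alpha x)(\beta y)=\sum\alpha\,\bigl(x_1\rightharpoonup\beta\leftharpoonup\mathcal{S}^{-1}(x_3)\bigr)\,x_2\,y,\qquad (a\rightharpoonup\beta\leftharpoonup b)(h)=\beta(b\,h\,a).$$ Then there is a $*$-Hopf algebra structure on $D(H)$ for which $H$ and $(H^\vee)^{\mathrm{cop}}$ are sub-$*$-Hopf algebras of $D(H)$ (it is necessarily given by $(\alpha x)^*=x^*\alpha^*$), and with this structure $H$ is a CQG if and only if $D(H)$ is a CQG. -/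

import Mathlib

open scoped TensorProduct
open Coalgebra HopfAlgebra

/-- A `*`-Hopf algebra: a Hopf algebra over `ℂ` with a conjugate-linear involution `x ↦ x^*` that
reverses products and preserves coproducts: `Δ(x^*) = ∑ x₁^* ⊗ x₂^*`. -/
class StarHopfAlgebra (H : Type*) [Ring H] [HopfAlgebra ℂ H]
    extends StarRing H, StarModule ℂ H where
  comul_star : ∀ x : H, comul (R := ℂ) (star x) = Star.star (comul (R := ℂ) x)

/-- The antipode is bijective. This is what the definition of the double uses; below it is proved
for every `*`-Hopf algebra. -/
class BijectiveAntipode (H : Type*) [Ring H] [HopfAlgebra ℂ H] : Prop where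
  bijective : Function.Bijective (antipode ℂ (A := H))

section Antipode

variable {H : Type*} [Ring H] [HopfAlgebra ℂ H]

theorem antipode_eq_of_inv (T : H →ₗ[ℂ] H)
    (hT : ∀ x, LinearMap.mul' ℂ H (T.rTensor H (comul x)) = algebraMap ℂ H (counit x)) :
    T = antipode ℂ := by
  have h : WithConv.toConv T = WithConv.toConv (antipode ℂ (A := H)) := by
    apply left_inv_eq_right_inv (a := WithConv.toConv (LinearMap.id (R := ℂ) (M := H)))
    · ext x
      simpa [LinearMap.rTensor] using hT x
    · exact LinearMap.id_mul_antipode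
  exact congrArg WithConv.ofConv h

theorem StarHopfAlgebra.counit_star [StarHopfAlgebra H] (x : H) :
    counit (R := ℂ) (star x) = star (counit (R := ℂ) x) := by
  -- `x ↦ star (ε (star x))` is again a counit
  have hr : ∑ i ∈ (ℛ ℂ x).index, star ((ℛ ℂ x).left i) ⊗ₜ[ℂ] star ((ℛ ℂ x).right i)
      = comul (star x) := by
    rw [StarHopfAlgebra.comul_star, ← (ℛ ℂ x).eq, star_sum]; simp
  have h1 : ∑ i ∈ (ℛ ℂ x).index,
      counit (R := ℂ) (star ((ℛ ℂ x).left i)) • star ((ℛ ℂ x).right i) = star x := by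
    have := congrArg (TensorProduct.lid ℂ H) (rTensor_counit_comul (R := ℂ) (star x))
    rw [← hr] at this
    simpa using this
  have h2 : ∑ i ∈ (ℛ ℂ x).index,
      star (counit (R := ℂ) (star ((ℛ ℂ x).left i))) • ((ℛ ℂ x).right i) = x := by
    have := congrArg star h1
    simpa [star_sum] using this
  have h3 := congrArg (fun y => star (counit (R := ℂ) y)) h2
  have h4 := congrArg (fun y => counit (R := ℂ) (star y)) (sum_counit_smul (ℛ ℂ x))
  have h5 : ∑ i ∈ (ℛ ℂ x).index, (counit (R := ℂ) (star ((ℛ ℂ x).left i))) *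
      star (counit (R := ℂ) ((ℛ ℂ x).right i)) = star (counit (R := ℂ) x) := by
    simpa [star_sum, map_sum] using h3
  have h6 := congrArg (fun y => counit (R := ℂ) (star y))
    (show ∑ i ∈ (ℛ ℂ x).index, counit (R := ℂ) ((ℛ ℂ x).right i) • (ℛ ℂ x).left i = x by
      have := congrArg (TensorProduct.rid ℂ H) (lTensor_counit_comul (R := ℂ) x)
      rw [← (ℛ ℂ x).eq] at this
      simpa only [map_sum, LinearMap.lTensor_tmul, TensorProduct.rid_tmul, one_smul] using this)
  rw [← h5, ← h6]
  simp [star_sum, map_sum, mul_comm]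

theorem StarHopfAlgebra.antipode_star_antipode [StarHopfAlgebra H] (x : H) :
    antipode ℂ (star (antipode ℂ (star x))) = x := by
  let T : H →ₗ[ℂ] H :=
    { toFun := fun x => star (antipode ℂ (star x))
      map_add' := by simp
      map_smul' := by simp }
  have h : WithConv.toConv (LinearMap.id (R := ℂ) (M := H)) =
      WithConv.toConv (antipode ℂ ∘ₗ T) := by
    apply left_inv_eq_right_inv (a := WithConv.toConv (antipode ℂ (A := H)))
    · exact LinearMap.id_mul_antipode
    · ext x
      rw [(ℛ ℂ x).convMul_apply]
      have h1 : ∑ i ∈ (ℛ ℂ x).index, star ((ℛ ℂ x).left i) ⊗ₜ[ℂ] star ((ℛ ℂ x).right i)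
          = comul (star x) := by
        rw [StarHopfAlgebra.comul_star, ← (ℛ ℂ x).eq, star_sum]; simp
      have h2 := congrArg star (mul_antipode_lTensor_comul_apply (R := ℂ) (star x))
      rw [← h1, StarHopfAlgebra.counit_star] at h2
      have h3 : ∑ i ∈ (ℛ ℂ x).index, T ((ℛ ℂ x).right i) * (ℛ ℂ x).left i
          = algebraMap ℂ H (counit x) := by
        simpa [star_sum, map_sum, T, Algebra.algebraMap_eq_smul_one] using h2
      have h4 := congrArg (antipode ℂ) h3
      simpa [map_sum, antipode_mul_antidistrib, Algebra.algebraMap_eq_smul_one] using h4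
  exact (LinearMap.congr_fun (congrArg WithConv.ofConv h) x).symm

instance StarHopfAlgebra.bijectiveAntipode [StarHopfAlgebra H] : BijectiveAntipode H where
  bijective := by
    have h : Function.RightInverse (fun x : H => star (antipode ℂ (star x))) (antipode ℂ (A := H)) :=
      StarHopfAlgebra.antipode_star_antipode
    refine ⟨Function.LeftInverse.injective (g := fun x : H => star (antipode ℂ (star x)))
      (fun x => ?_), h.surjective⟩
    have := congrArg star (h (star x))
    simpa using this

theorem comul_comul_eq : TensorProduct.map comul comul ∘ₗ comul (R := ℂ) (A := H) =
    (TensorProduct.assoc ℂ H H (H ⊗[ℂ] H)).symm.toLinearMap ∘ₗ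
    TensorProduct.map LinearMap.id ((TensorProduct.assoc ℂ H H H).toLinearMap ∘ₗ
      TensorProduct.map comul LinearMap.id) ∘ₗ
    TensorProduct.map LinearMap.id comul ∘ₗ comul := by
  simp only [coassoc_simps]

theorem comul_antipode (x : H) : comul (R := ℂ) (antipode ℂ x) =
    TensorProduct.map (antipode ℂ) (antipode ℂ) (TensorProduct.comm ℂ H H (comul x)) := by
  have h : WithConv.toConv (TensorProduct.map (antipode ℂ) (antipode ℂ) ∘ₗ
      (TensorProduct.comm ℂ H H).toLinearMap ∘ₗ comul) =
      WithConv.toConv (comul (R := ℂ) (A := H) ∘ₗ antipode ℂ) := by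
    apply left_inv_eq_right_inv (a := WithConv.toConv (comul (R := ℂ) (A := H)))
    · let Φ : (H ⊗[ℂ] H) ⊗[ℂ] (H ⊗[ℂ] H) →ₗ[ℂ] H ⊗[ℂ] H :=
        LinearMap.mul' ℂ (H ⊗[ℂ] H) ∘ₗ (TensorProduct.map (antipode ℂ) (antipode ℂ) ∘ₗ
          (TensorProduct.comm ℂ H H).toLinearMap).rTensor (H ⊗[ℂ] H)
      have h1 : Φ ∘ₗ (TensorProduct.assoc ℂ H H (H ⊗[ℂ] H)).symm.toLinearMap ∘ₗ
          TensorProduct.map LinearMap.id ((TensorProduct.assoc ℂ H H H).toLinearMap ∘ₗ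
          TensorProduct.map comul LinearMap.id) =
          (TensorProduct.mk ℂ H H 1) ∘ₗ LinearMap.mul' ℂ H ∘ₗ
          TensorProduct.map (antipode ℂ) ((TensorProduct.lid ℂ H).toLinearMap ∘ₗ
            counit.rTensor H) := by
        ext a b d
        have := sum_antipode_mul_eq_algebraMap_counit (ℛ ℂ b)
        rw [Algebra.algebraMap_eq_smul_one] at this
        simp only [TensorProduct.AlgebraTensorModule.curry_apply, LinearMap.restrictScalars_self,
          TensorProduct.curry_apply, LinearMap.comp_apply, TensorProduct.map_tmul,
          LinearMap.id_apply, ← (ℛ ℂ b).eq, TensorProduct.sum_tmul, map_sum,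
          TensorProduct.tmul_sum]
        simp [Φ, ← TensorProduct.sum_tmul, this, TensorProduct.smul_tmul']
      have h2 : Φ ∘ₗ TensorProduct.map comul comul ∘ₗ comul (R := ℂ) (A := H) =
          Algebra.linearMap ℂ (H ⊗[ℂ] H) ∘ₗ counit := by
        rw [comul_comul_eq]
        ext x
        have h3 := LinearMap.congr_fun h1 (TensorProduct.map LinearMap.id comul (comul x))
        have h4 := sum_antipode_mul_eq_algebraMap_counit (ℛ ℂ x)
        simp only [LinearMap.comp_apply] at h3 ⊢
        rw [h3]
        nth_rewrite 1 [← (ℛ ℂ x).eq]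
        simp [map_sum, h4, Algebra.algebraMap_eq_smul_one,
          Algebra.TensorProduct.one_def]
      apply WithConv.ext
      rw [LinearMap.convOne_def, ← h2]
      ext x
      rw [LinearMap.convMul_def]
      simp only [Φ, LinearMap.comp_apply]
      rw [← (ℛ ℂ x).eq]
      simp [map_sum]
    · exact LinearMap.comul_right_inv
  exact (LinearMap.congr_fun (congrArg WithConv.ofConv h) x).symm

variable [BijectiveAntipode H]

variable (H) in
/-- The inverse of the antipode. -/
noncomputable def antipodeInv : H →ₗ[ℂ] H :=
  (LinearEquiv.ofBijective (antipode ℂ (A := H)) BijectiveAntipode.bijective).symm.toLinearMap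

@[simp] theorem antipodeInv_antipode (x : H) : antipodeInv H (antipode ℂ x) = x :=
  (LinearEquiv.ofBijective (antipode ℂ (A := H)) BijectiveAntipode.bijective).symm_apply_apply x

@[simp] theorem antipode_antipodeInv (x : H) : antipode ℂ (antipodeInv H x) = x :=
  (LinearEquiv.ofBijective (antipode ℂ (A := H)) BijectiveAntipode.bijective).apply_symm_apply x

theorem antipodeInv_mul (x y : H) :
    antipodeInv H (x * y) = antipodeInv H y * antipodeInv H x := by
  apply BijectiveAntipode.bijective.injective
  simp [antipode_mul_antidistrib]

@[simp] theorem antipodeInv_one : antipodeInv H 1 = 1 := by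
  apply BijectiveAntipode.bijective.injective
  simp

theorem sum_mul_antipodeInv {x : H} {ι : Type*} (r : Repr ℂ x ι) :
    ∑ i ∈ r.index, r.right i * antipodeInv H (r.left i) = algebraMap ℂ H (counit x) := by
  apply BijectiveAntipode.bijective.injective
  have := sum_mul_antipode_eq_algebraMap_counit r
  simpa [map_sum, antipode_mul_antidistrib, Algebra.algebraMap_eq_smul_one] using this

theorem sum_antipodeInv_mul {x : H} {ι : Type*} (r : Repr ℂ x ι) :
    ∑ i ∈ r.index, antipodeInv H (r.right i) * r.left i = algebraMap ℂ H (counit x) := by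
  apply BijectiveAntipode.bijective.injective
  have := sum_antipode_mul_eq_algebraMap_counit r
  simpa [map_sum, antipode_mul_antidistrib, Algebra.algebraMap_eq_smul_one] using this

theorem comul_antipodeInv (x : H) : comul (R := ℂ) (antipodeInv H x) =
    TensorProduct.map (antipodeInv H) (antipodeInv H) (TensorProduct.comm ℂ H H (comul x)) := by
  obtain ⟨y, rfl⟩ := BijectiveAntipode.bijective.surjective x
  rw [comul_antipode, antipodeInv_antipode, ← (ℛ ℂ y).eq]
  simp [map_sum]

end Antipode

section Dual

/-- The dual `H^∨`, with convolution product `(αβ)(x) = ∑ α(x₁) β(x₂)`, unit `ε`, and (see below)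
the *opposite* of the usual coproduct: as a Hopf algebra it is `(H^∨)^cop`. -/
def DualCop (H : Type*) [Ring H] [HopfAlgebra ℂ H] := WithConv (H →ₗ[ℂ] ℂ)

namespace DualCop

variable {H : Type*} [Ring H] [HopfAlgebra ℂ H]

noncomputable instance : Ring (DualCop H) := inferInstanceAs (Ring (WithConv (H →ₗ[ℂ] ℂ)))

noncomputable instance : Algebra ℂ (DualCop H) :=
  inferInstanceAs (Algebra ℂ (WithConv (H →ₗ[ℂ] ℂ)))

variable (H) in
/-- `DualCop H` is the dual space of `H`. -/
noncomputable def toDual : DualCop H ≃ₗ[ℂ] Module.Dual ℂ H := WithConv.linearEquiv ℂ (H →ₗ[ℂ] ℂ)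

theorem toDual_injective' {α β : DualCop H} (h : ∀ x, toDual H α x = toDual H β x) : α = β :=
  (toDual H).injective (LinearMap.ext h)

theorem toDual_one (x : H) : toDual H 1 x = counit (R := ℂ) x := rfl

theorem toDual_algebraMap (c : ℂ) (x : H) :
    toDual H (algebraMap ℂ _ c) x = c * counit (R := ℂ) x := rfl

theorem toDual_mul (α β : DualCop H) (x : H) : toDual H (α * β) x =
    LinearMap.mul' ℂ ℂ (TensorProduct.map (toDual H α) (toDual H β) (comul x)) := rfl

theorem toDual_mul_repr (α β : DualCop H) {x : H} {ι : Type*} (r : Repr ℂ x ι) :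
    toDual H (α * β) x = ∑ i ∈ r.index, toDual H α (r.left i) * toDual H β (r.right i) := by
  rw [toDual_mul, ← r.eq]
  simp [map_sum]

variable [FiniteDimensional ℂ H]

variable (H) in
/-- `H^∨ ⊗ H^∨` is the dual of `H ⊗ H`. -/
noncomputable def toDual₂ : DualCop H ⊗[ℂ] DualCop H ≃ₗ[ℂ] Module.Dual ℂ (H ⊗[ℂ] H) :=
  (TensorProduct.congr (toDual H) (toDual H)).trans (TensorProduct.dualDistribEquiv ℂ H H)

@[simp] theorem toDual₂_tmul (α β : DualCop H) (x y : H) :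
    toDual₂ H (α ⊗ₜ β) (x ⊗ₜ y) = toDual H α x * toDual H β y := rfl

variable (H) in
/-- `H^∨ ⊗ (H^∨ ⊗ H^∨)` is the dual of `H ⊗ (H ⊗ H)`. -/
noncomputable def toDual₃ :
    DualCop H ⊗[ℂ] (DualCop H ⊗[ℂ] DualCop H) ≃ₗ[ℂ] Module.Dual ℂ (H ⊗[ℂ] (H ⊗[ℂ] H)) :=
  (TensorProduct.congr (toDual H) (toDual₂ H)).trans (TensorProduct.dualDistribEquiv ℂ H (H ⊗[ℂ] H))

@[simp] theorem toDual₃_tmul (α : DualCop H) (t : DualCop H ⊗[ℂ] DualCop H) (x : H)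
    (u : H ⊗[ℂ] H) :
    toDual₃ H (α ⊗ₜ t) (x ⊗ₜ u) = toDual H α x * toDual₂ H t u := rfl

theorem toDual₂_ext {s t : DualCop H ⊗[ℂ] DualCop H}
    (h : ∀ x y, toDual₂ H s (x ⊗ₜ y) = toDual₂ H t (x ⊗ₜ y)) : s = t :=
  (toDual₂ H).injective (TensorProduct.ext' h)

/-- The coproduct of `(H^∨)^cop`: it is determined by `∑ α₍₁₎(x) α₍₂₎(y) = α(y x)`.
The counit is evaluation at `1`. -/
noncomputable instance : CoalgebraStruct ℂ (DualCop H) where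
  comul := (toDual₂ H).symm.toLinearMap ∘ₗ
    (LinearMap.mul' ℂ H ∘ₗ (TensorProduct.comm ℂ H H).toLinearMap).dualMap ∘ₗ
    (toDual H).toLinearMap
  counit := LinearMap.applyₗ 1 ∘ₗ (toDual H).toLinearMap

@[simp] theorem toDual₂_comul (α : DualCop H) (x y : H) :
    toDual₂ H (comul α) (x ⊗ₜ y) = toDual H α (y * x) := by
  simp [comul]

theorem counit_eq (α : DualCop H) : counit (R := ℂ) α = toDual H α 1 := rfl

theorem toDual₃_lTensor_comul (t : DualCop H ⊗[ℂ] DualCop H) (x y z : H) :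
    toDual₃ H (comul.lTensor _ t) (x ⊗ₜ (y ⊗ₜ z)) = toDual₂ H t (x ⊗ₜ (z * y)) := by
  induction t with
  | zero => simp
  | add s t hs ht => simp [hs, ht]
  | tmul α β => simp

theorem toDual₃_assoc (t : DualCop H ⊗[ℂ] DualCop H) (β : DualCop H) (x y z : H) :
    toDual₃ H (TensorProduct.assoc ℂ _ _ _ (t ⊗ₜ β)) (x ⊗ₜ (y ⊗ₜ z)) =
      toDual₂ H t (x ⊗ₜ y) * toDual H β z := by
  induction t with
  | zero => simp
  | add s t hs ht => simp [hs, ht, TensorProduct.add_tmul, add_mul]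
  | tmul α γ => simp [mul_assoc]

theorem toDual₃_assoc_rTensor_comul (t : DualCop H ⊗[ℂ] DualCop H) (x y z : H) :
    toDual₃ H (TensorProduct.assoc ℂ _ _ _ (comul.rTensor _ t)) (x ⊗ₜ (y ⊗ₜ z)) =
      toDual₂ H t ((y * x) ⊗ₜ z) := by
  induction t with
  | zero => simp
  | add s t hs ht => simp [hs, ht]
  | tmul α β => simp [toDual₃_assoc]

theorem toDual_lid (t : DualCop H ⊗[ℂ] DualCop H) (x : H) :
    toDual H (TensorProduct.lid ℂ _ (counit.rTensor _ t)) x = toDual₂ H t (1 ⊗ₜ x) := by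
  induction t with
  | zero => simp
  | add s t hs ht => simp [hs, ht]
  | tmul α β => simp [counit_eq]

theorem toDual_rid (t : DualCop H ⊗[ℂ] DualCop H) (x : H) :
    toDual H (TensorProduct.rid ℂ _ (counit.lTensor _ t)) x = toDual₂ H t (x ⊗ₜ 1) := by
  induction t with
  | zero => simp
  | add s t hs ht => simp [hs, ht]
  | tmul α β => simp [counit_eq, mul_comm]

noncomputable instance : Coalgebra ℂ (DualCop H) where
  coassoc := by
    ext α : 1
    apply (toDual₃ H).injective
    apply TensorProduct.ext
    ext x : 1
    apply TensorProduct.ext'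
    intro y z
    simp [toDual₃_lTensor_comul, toDual₃_assoc_rTensor_comul, mul_assoc]
  rTensor_counit_comp_comul := by
    ext α : 1
    apply (TensorProduct.lid ℂ _).injective
    apply toDual_injective'
    intro x
    simp [toDual_lid]
  lTensor_counit_comp_comul := by
    ext α : 1
    apply (TensorProduct.rid ℂ _).injective
    apply toDual_injective'
    intro x
    simp [toDual_rid]

theorem toDual₂_mul (s t : DualCop H ⊗[ℂ] DualCop H) {x y : H} {ι κ : Type*}
    (r : Repr ℂ x ι) (q : Repr ℂ y κ) :
    toDual₂ H (s * t) (x ⊗ₜ y) = ∑ i ∈ r.index, ∑ j ∈ q.index,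
      toDual₂ H s (r.left i ⊗ₜ q.left j) * toDual₂ H t (r.right i ⊗ₜ q.right j) := by
  induction s with
  | zero => simp
  | add s s' hs hs' => simp [hs, hs', add_mul, Finset.sum_add_distrib]
  | tmul α β =>
    induction t with
    | zero => simp
    | add t t' ht ht' => simp [ht, ht', mul_add, Finset.sum_add_distrib]
    | tmul γ δ =>
      simp only [Algebra.TensorProduct.tmul_mul_tmul, toDual₂_tmul, toDual_mul_repr _ _ r,
        toDual_mul_repr _ _ q, Finset.sum_mul_sum]
      exact Finset.sum_congr rfl fun i _ => Finset.sum_congr rfl fun j _ => by ring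

theorem toDual_mul_mul (α β : DualCop H) {x y : H} {ι κ : Type*}
    (r : Repr ℂ x ι) (q : Repr ℂ y κ) :
    toDual H (α * β) (x * y) = ∑ i ∈ r.index, ∑ j ∈ q.index,
      toDual H α (r.left i * q.left j) * toDual H β (r.right i * q.right j) := by
  rw [toDual_mul, Bialgebra.comul_mul, ← r.eq, ← q.eq, Finset.sum_mul_sum]
  simp [map_sum]

noncomputable instance : Bialgebra ℂ (DualCop H) :=
  Bialgebra.mk' ℂ (DualCop H)
    (by simp [counit_eq, toDual_one])
    (by
      intro α β
      simp [counit_eq, toDual_mul, Algebra.TensorProduct.one_def])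
    (by
      apply toDual₂_ext
      intro x y
      simp [Algebra.TensorProduct.one_def, toDual_one, mul_comm])
    (by
      intro α β
      apply toDual₂_ext
      intro x y
      rw [toDual₂_comul, toDual₂_mul _ _ (ℛ ℂ x) (ℛ ℂ y), toDual_mul_mul _ _ (ℛ ℂ y) (ℛ ℂ x),
        Finset.sum_comm]
      simp)

variable [BijectiveAntipode H]

/-- The antipode of `(H^∨)^cop` is `α ↦ α ∘ S⁻¹`. -/
noncomputable instance : HopfAlgebraStruct ℂ (DualCop H) where
  antipode := (toDual H).symm.toLinearMap ∘ₗ (antipodeInv H).dualMap ∘ₗ (toDual H).toLinearMap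

@[simp] theorem toDual_antipode (α : DualCop H) (x : H) :
    toDual H (antipode ℂ α) x = toDual H α (antipodeInv H x) := by
  simp [antipode]

theorem toDual_mul'_rTensor_antipode (t : DualCop H ⊗[ℂ] DualCop H) {x : H} {ι : Type*}
    (r : Repr ℂ x ι) :
    toDual H (LinearMap.mul' ℂ _ ((antipode ℂ).rTensor _ t)) x =
      ∑ i ∈ r.index, toDual₂ H t (antipodeInv H (r.left i) ⊗ₜ r.right i) := by
  induction t with
  | zero => simp
  | add s t hs ht => simp [hs, ht, Finset.sum_add_distrib]
  | tmul α β => simp [toDual_mul_repr _ _ r]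

theorem toDual_mul'_lTensor_antipode (t : DualCop H ⊗[ℂ] DualCop H) {x : H} {ι : Type*}
    (r : Repr ℂ x ι) :
    toDual H (LinearMap.mul' ℂ _ ((antipode ℂ).lTensor _ t)) x =
      ∑ i ∈ r.index, toDual₂ H t (r.left i ⊗ₜ antipodeInv H (r.right i)) := by
  induction t with
  | zero => simp
  | add s t hs ht => simp [hs, ht, Finset.sum_add_distrib]
  | tmul α β => simp [toDual_mul_repr _ _ r]

noncomputable instance : HopfAlgebra ℂ (DualCop H) where
  mul_antipode_rTensor_comul := by
    ext α : 1
    apply toDual_injective'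
    intro x
    have := sum_mul_antipodeInv (ℛ ℂ x)
    simp [toDual_mul'_rTensor_antipode _ (ℛ ℂ x), ← map_sum, this, counit_eq,
      Algebra.algebraMap_eq_smul_one, mul_comm, toDual_one]
  mul_antipode_lTensor_comul := by
    ext α : 1
    apply toDual_injective'
    intro x
    have := sum_antipodeInv_mul (ℛ ℂ x)
    simp [toDual_mul'_lTensor_antipode _ (ℛ ℂ x), ← map_sum, this, counit_eq,
      Algebra.algebraMap_eq_smul_one, mul_comm, toDual_one]

end DualCop

end Dual

section Double

variable (H : Type*) [Ring H] [HopfAlgebra ℂ H] [FiniteDimensional ℂ H] [BijectiveAntipode H]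

namespace DrinfeldDouble

variable {H}

/-- The functional `y ↦ α(z y x)`. -/
noncomputable def coreg (x z : H) : DualCop H →ₗ[ℂ] DualCop H :=
  (DualCop.toDual H).symm.toLinearMap ∘ₗ
    (LinearMap.mulLeft ℂ z ∘ₗ LinearMap.mulRight ℂ x).dualMap ∘ₗ
    (DualCop.toDual H).toLinearMap

@[simp] theorem toDual_coreg (x z : H) (α : DualCop H) (y : H) :
    DualCop.toDual H (coreg x z α) y = DualCop.toDual H α (z * (y * x)) := by
  simp [coreg]

variable (H) in
/-- `coreg` as a bilinear map. -/
noncomputable def coregₗ : H →ₗ[ℂ] H →ₗ[ℂ] Module.End ℂ (DualCop H) :=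
  LinearMap.mk₂ ℂ coreg
    (fun x x' z => by
      ext α; apply DualCop.toDual_injective'; simp [mul_add])
    (fun c x z => by
      ext α; apply DualCop.toDual_injective'; simp)
    (fun x z z' => by
      ext α; apply DualCop.toDual_injective'; simp [add_mul])
    (fun c x z => by
      ext α; apply DualCop.toDual_injective'; simp)

@[simp] theorem coregₗ_apply (x z : H) : coregₗ H x z = coreg x z := rfl

theorem coreg_one_one : coreg (1 : H) 1 = LinearMap.id := by
  ext α; apply DualCop.toDual_injective'; simp

theorem coreg_coreg (x z x' z' : H) (α : DualCop H) :
    coreg x z (coreg x' z' α) = coreg (x * x') (z' * z) α := by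
  apply DualCop.toDual_injective'; simp [mul_assoc]

theorem coreg_one_apply (x z : H) :
    coreg x z (1 : DualCop H) = (counit (R := ℂ) z * counit (R := ℂ) x) • 1 := by
  apply DualCop.toDual_injective'; intro y; simp [DualCop.toDual_one]; ring

theorem coreg_mul {x z : H} {ι κ : Type*} (r : Repr ℂ x ι) (q : Repr ℂ z κ) (α β : DualCop H) :
    coreg x z (α * β) = ∑ i ∈ r.index, ∑ j ∈ q.index,
      coreg (r.left i) (q.left j) α * coreg (r.right i) (q.right j) β := by
  apply DualCop.toDual_injective'
  intro y
  rw [toDual_coreg, DualCop.toDual_mul, Bialgebra.comul_mul, Bialgebra.comul_mul, ← r.eq, ← q.eq]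
  simp only [map_sum, LinearMap.sum_apply, DualCop.toDual_mul_repr _ _ (ℛ ℂ y), toDual_coreg]
  rw [← (ℛ ℂ y).eq]
  simp only [Finset.sum_mul, Finset.mul_sum, map_sum, Algebra.TensorProduct.tmul_mul_tmul,
    TensorProduct.map_tmul, LinearMap.mul'_apply]
  refine Finset.sum_congr rfl fun i _ => ?_
  rw [Finset.sum_comm]

variable (H) in
/-- The map `p ⊗ q ⊗ r ↦ (β ⊗ y ↦ β(S⁻¹(r) · p) ⊗ q y)`. -/
noncomputable def trip : H →ₗ[ℂ] H →ₗ[ℂ] H →ₗ[ℂ] Module.End ℂ (DualCop H ⊗[ℂ] H) :=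
  LinearMap.mk₂ ℂ (fun p q =>
      ((TensorProduct.mapBilinear (RingHom.id ℂ) (DualCop H) H (DualCop H) H).flip
        (LinearMap.mulLeft ℂ q)) ∘ₗ (coregₗ H p) ∘ₗ antipodeInv H)
    (fun p p' q => by ext; simp)
    (fun c p q => by ext; simp [TensorProduct.smul_tmul'])
    (fun p q q' => by ext; simp [TensorProduct.tmul_add, add_mul])
    (fun c p q => by ext; simp)

@[simp] theorem trip_apply (p q r : H) (β : DualCop H) (y : H) :
    trip H p q r (β ⊗ₜ y) = coreg p (antipodeInv H r) β ⊗ₜ (q * y) := rfl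

/-- Turns a trilinear map into a linear map on `P ⊗ (Q ⊗ R)`. -/
noncomputable def uncurry₃ {P Q R X : Type*} [AddCommGroup P] [AddCommGroup Q] [AddCommGroup R]
    [AddCommGroup X] [Module ℂ P] [Module ℂ Q] [Module ℂ R] [Module ℂ X]
    (f : P →ₗ[ℂ] Q →ₗ[ℂ] R →ₗ[ℂ] X) : P ⊗[ℂ] (Q ⊗[ℂ] R) →ₗ[ℂ] X :=
  TensorProduct.lift ((TensorProduct.lift.equiv (.id ℂ) Q R X).toLinearMap ∘ₗ f)

@[simp] theorem uncurry₃_tmul {P Q R X : Type*} [AddCommGroup P] [AddCommGroup Q] [AddCommGroup R]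
    [AddCommGroup X] [Module ℂ P] [Module ℂ Q] [Module ℂ R] [Module ℂ X]
    (f : P →ₗ[ℂ] Q →ₗ[ℂ] R →ₗ[ℂ] X) (p : P) (q : Q) (r : R) :
    uncurry₃ f (p ⊗ₜ (q ⊗ₜ r)) = f p q r := rfl

variable (H) in
/-- `x ↦ x₁ ⊗ (x₂ ⊗ x₃)`. -/
noncomputable def comul₃ : H →ₐ[ℂ] H ⊗[ℂ] (H ⊗[ℂ] H) :=
  (Algebra.TensorProduct.map (.id ℂ H) (Bialgebra.comulAlgHom ℂ H)).comp
    (Bialgebra.comulAlgHom ℂ H)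

theorem comul₃_toLinearMap :
    (comul₃ H).toLinearMap = TensorProduct.map LinearMap.id comul ∘ₗ comul := rfl

variable (H) in
/-- Left multiplication by `x ∈ H` on the double:
`x · (β ⊗ y) = ∑ β(S⁻¹(x₃) · x₁) ⊗ x₂ y`. -/
noncomputable def leftMul : H →ₗ[ℂ] Module.End ℂ (DualCop H ⊗[ℂ] H) :=
  uncurry₃ (trip H) ∘ₗ (comul₃ H).toLinearMap

variable (H) in
/-- Left multiplication by `α ∈ H^∨`: `α · (β ⊗ y) = α β ⊗ y`. -/
noncomputable def leftMulDual : DualCop H →ₗ[ℂ] Module.End ℂ (DualCop H ⊗[ℂ] H) :=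
  LinearMap.mul ℂ (DualCop H ⊗[ℂ] H) ∘ₗ (TensorProduct.mk ℂ (DualCop H) H).flip 1

@[simp] theorem leftMulDual_tmul (α β : DualCop H) (y : H) :
    leftMulDual H α (β ⊗ₜ y) = (α * β) ⊗ₜ y := by
  simp [leftMulDual]

variable (H) in
/-- The product of the double:
`(α ⊗ x)(β ⊗ y) = ∑ α (x₁ ⇀ β ↼ S⁻¹(x₃)) ⊗ x₂ y`,
where `(x ⇀ β ↼ z)(h) = β(z h x)`. -/
noncomputable def mulₗ : DualCop H ⊗[ℂ] H →ₗ[ℂ] Module.End ℂ (DualCop H ⊗[ℂ] H) :=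
  TensorProduct.lift ((LinearMap.mul ℂ _).compl₁₂ (leftMulDual H) (leftMul H))

theorem mulₗ_tmul (α : DualCop H) (x : H) : mulₗ H (α ⊗ₜ x) = leftMulDual H α * leftMul H x := rfl

theorem uncurry_trip_mul (s t : H ⊗[ℂ] (H ⊗[ℂ] H)) :
    uncurry₃ (trip H) (s * t) = uncurry₃ (trip H) s * uncurry₃ (trip H) t := by
  have : (LinearMap.mul ℂ (H ⊗[ℂ] (H ⊗[ℂ] H))).compr₂ (uncurry₃ (trip H)) =
      (LinearMap.mul ℂ (Module.End ℂ (DualCop H ⊗[ℂ] H))).compl₁₂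
        (uncurry₃ (trip H)) (uncurry₃ (trip H)) := by
    ext p q r p' q' r' β y
    simp [coreg_coreg, antipodeInv_mul, mul_assoc]
  exact LinearMap.congr_fun (LinearMap.congr_fun this s) t

theorem leftMul_mul (x y : H) : leftMul H (x * y) = leftMul H x * leftMul H y := by
  simp [leftMul, uncurry_trip_mul]

theorem leftMul_one : leftMul H 1 = 1 := by
  ext β y
  simp [leftMul, Algebra.TensorProduct.one_def, coreg_one_one]

theorem leftMulDual_mul (α β : DualCop H) :
    leftMulDual H (α * β) = leftMulDual H α * leftMulDual H β := by
  ext γ y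
  simp [mul_assoc]

theorem leftMulDual_one : leftMulDual H 1 = 1 := by
  ext γ y
  simp

theorem comul₃_comul₃ :
    TensorProduct.map LinearMap.id (TensorProduct.map (comul₃ H).toLinearMap LinearMap.id) ∘ₗ
      (comul₃ H).toLinearMap =
    (TensorProduct.map LinearMap.id ((TensorProduct.assoc ℂ H (H ⊗[ℂ] H) H).symm.toLinearMap ∘ₗ
      TensorProduct.map LinearMap.id (TensorProduct.assoc ℂ H H H).symm.toLinearMap) ∘ₗ
      (TensorProduct.assoc ℂ H H (H ⊗[ℂ] (H ⊗[ℂ] H))).toLinearMap) ∘ₗ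
    TensorProduct.map comul (TensorProduct.map LinearMap.id comul) ∘ₗ (comul₃ H).toLinearMap := by
  simp only [comul₃_toLinearMap, coassoc_simps]

variable (H) in
/-- Auxiliary map `p ⊗ (s ⊗ r) ↦ L(β(S⁻¹(r) · p)) ∘ B(s)`,
where `L` is `leftMulDual` and `B` is the map that defines `leftMul`. -/
noncomputable def assocAux (β : DualCop H) :
    H ⊗[ℂ] ((H ⊗[ℂ] (H ⊗[ℂ] H)) ⊗[ℂ] H) →ₗ[ℂ] Module.End ℂ (DualCop H ⊗[ℂ] H) :=
  uncurry₃ (LinearMap.mk₂ ℂ (fun p s => LinearMap.mulRight ℂ (uncurry₃ (trip H) s) ∘ₗ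
      leftMulDual H ∘ₗ LinearMap.applyₗ β ∘ₗ coregₗ H p ∘ₗ antipodeInv H)
    (fun p p' s => by ext : 1; simp [add_mul])
    (fun c p s => by ext : 1; simp)
    (fun p s s' => by ext : 1; simp [mul_add])
    (fun c p s => by ext : 1; simp))

@[simp] theorem assocAux_tmul (β : DualCop H) (p r : H) (s : H ⊗[ℂ] (H ⊗[ℂ] H)) :
    assocAux H β (p ⊗ₜ (s ⊗ₜ r)) =
      leftMulDual H (coreg p (antipodeInv H r) β) * uncurry₃ (trip H) s := rfl

theorem trip_mul_leftMulDual (β : DualCop H) (p q r : H) :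
    trip H p q r * leftMulDual H β =
    assocAux H β ((TensorProduct.map LinearMap.id
        ((TensorProduct.assoc ℂ H (H ⊗[ℂ] H) H).symm.toLinearMap ∘ₗ
        TensorProduct.map LinearMap.id (TensorProduct.assoc ℂ H H H).symm.toLinearMap) ∘ₗ
        (TensorProduct.assoc ℂ H H (H ⊗[ℂ] (H ⊗[ℂ] H))).toLinearMap)
      (TensorProduct.map comul (TensorProduct.map LinearMap.id comul) (p ⊗ₜ (q ⊗ₜ r)))) := by
  have hq : comul (antipodeInv H r) = ∑ j ∈ (ℛ ℂ r).index,
      antipodeInv H ((ℛ ℂ r).right j) ⊗ₜ[ℂ] antipodeInv H ((ℛ ℂ r).left j) := by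
    rw [comul_antipodeInv, ← (ℛ ℂ r).eq]; simp [map_sum]
  ext γ w
  simp only [TensorProduct.map_tmul, ← (ℛ ℂ p).eq, ← (ℛ ℂ r).eq, TensorProduct.sum_tmul,
    TensorProduct.tmul_sum, map_sum, LinearMap.id_apply]
  simp only [TensorProduct.AlgebraTensorModule.curry_apply, LinearMap.restrictScalars_self,
    TensorProduct.curry_apply, Module.End.mul_apply, leftMulDual_tmul, trip_apply]
  rw [coreg_mul (ℛ ℂ p) ⟨_, _, _, hq.symm⟩, Finset.sum_comm]
  simp [TensorProduct.sum_tmul]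

theorem leftMul_mul_leftMulDual (x : H) (β : DualCop H) :
    leftMul H x * leftMulDual H β = mulₗ H (leftMul H x (β ⊗ₜ 1)) := by
  have h1 : (LinearMap.mulRight ℂ (leftMulDual H β)) ∘ₗ uncurry₃ (trip H) =
      assocAux H β ∘ₗ (TensorProduct.map LinearMap.id
        ((TensorProduct.assoc ℂ H (H ⊗[ℂ] H) H).symm.toLinearMap ∘ₗ
        TensorProduct.map LinearMap.id (TensorProduct.assoc ℂ H H H).symm.toLinearMap) ∘ₗ
        (TensorProduct.assoc ℂ H H (H ⊗[ℂ] (H ⊗[ℂ] H))).toLinearMap) ∘ₗ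
      (TensorProduct.map comul (TensorProduct.map LinearMap.id comul)) := by
    apply TensorProduct.ext
    ext p : 1
    apply TensorProduct.ext'
    intro q r
    exact trip_mul_leftMulDual β p q r
  have h2 : mulₗ H ∘ₗ LinearMap.applyₗ (β ⊗ₜ[ℂ] (1 : H)) ∘ₗ uncurry₃ (trip H) =
      assocAux H β ∘ₗ TensorProduct.map LinearMap.id
        (TensorProduct.map (comul₃ H).toLinearMap LinearMap.id) := by
    apply TensorProduct.ext
    ext p : 1
    apply TensorProduct.ext'
    intro q r
    simp [mulₗ_tmul, leftMul]
  have h3 := LinearMap.congr_fun h1 (comul₃ H x)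
  have h4 := LinearMap.congr_fun h2 (comul₃ H x)
  have h5 := LinearMap.congr_fun (comul₃_comul₃ (H := H)) x
  simp only [LinearMap.comp_apply, AlgHom.toLinearMap_apply] at h3 h4 h5
  rw [h5, ← h3] at h4
  exact h4.symm

theorem mulₗ_mul_tmul (t : DualCop H ⊗[ℂ] H) (y : H) :
    mulₗ H t * leftMul H y = mulₗ H (t * (1 ⊗ₜ y)) := by
  induction t with
  | zero => simp
  | add s t hs ht => simp [add_mul, hs, ht]
  | tmul α x => simp [mulₗ_tmul, mul_assoc, leftMul_mul]

theorem uncurry_trip_apply_mul (s : H ⊗[ℂ] (H ⊗[ℂ] H)) (t : DualCop H ⊗[ℂ] H) (y : H) :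
    uncurry₃ (trip H) s (t * (1 ⊗ₜ y)) = uncurry₃ (trip H) s t * (1 ⊗ₜ y) := by
  induction s with
  | zero => simp
  | add s s' hs hs' => simp [hs, hs', add_mul]
  | tmul p s =>
    induction s with
    | zero => simp
    | add s s' hs hs' => simp [hs, hs', add_mul, TensorProduct.tmul_add]
    | tmul q r =>
      induction t with
      | zero => simp
      | add t t' ht ht' => simp only [add_mul, map_add, ht, ht']
      | tmul α x => simp [mul_assoc]

theorem mulₗ_leftMul (x : H) (v : DualCop H ⊗[ℂ] H) :
    mulₗ H (leftMul H x v) = leftMul H x * mulₗ H v := by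
  induction v with
  | zero => simp
  | add s t hs ht => simp [mul_add, hs, ht]
  | tmul β y =>
    have h : β ⊗ₜ[ℂ] y = (β ⊗ₜ 1) * (1 ⊗ₜ y) := by simp
    rw [mulₗ_tmul, ← mul_assoc, leftMul_mul_leftMulDual, mulₗ_mul_tmul, h]
    congr 1
    exact uncurry_trip_apply_mul _ _ _

theorem mulₗ_leftMulDual (α : DualCop H) (v : DualCop H ⊗[ℂ] H) :
    mulₗ H (leftMulDual H α v) = leftMulDual H α * mulₗ H v := by
  induction v with
  | zero => simp
  | add s t hs ht => simp [mul_add, hs, ht]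
  | tmul β y => simp [mulₗ_tmul, leftMulDual_mul, mul_assoc]

theorem mulₗ_mulₗ (u v : DualCop H ⊗[ℂ] H) :
    mulₗ H (mulₗ H u v) = mulₗ H u * mulₗ H v := by
  induction u with
  | zero => simp
  | add s t hs ht => simp [add_mul, hs, ht]
  | tmul α x => simp [mulₗ_tmul, mulₗ_leftMul, mulₗ_leftMulDual, mul_assoc]

theorem leftMul_apply_one (x : H) : leftMul H x (1 ⊗ₜ 1) = 1 ⊗ₜ x := by
  have h1 : LinearMap.applyₗ ((1 : DualCop H) ⊗ₜ[ℂ] (1 : H)) ∘ₗ uncurry₃ (trip H) =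
      TensorProduct.mk ℂ (DualCop H) H 1 ∘ₗ (TensorProduct.lid ℂ H).toLinearMap ∘ₗ
        TensorProduct.map counit ((TensorProduct.rid ℂ H).toLinearMap ∘ₗ
          TensorProduct.map LinearMap.id (counit ∘ₗ antipodeInv H)) := by
    apply TensorProduct.ext
    ext p : 1
    apply TensorProduct.ext'
    intro q r
    simp [coreg_one_apply, TensorProduct.smul_tmul', mul_comm]
  have h0 : counit (R := ℂ) ∘ₗ antipodeInv H = counit := by
    ext y
    obtain ⟨z, rfl⟩ := BijectiveAntipode.bijective.surjective y
    simp
  have h2 := LinearMap.congr_fun h1 (comul₃ H x)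
  have h3 : comul₃ H x = ∑ i ∈ (ℛ ℂ x).index, (ℛ ℂ x).left i ⊗ₜ comul ((ℛ ℂ x).right i) := by
    change TensorProduct.map LinearMap.id comul (comul x) = _
    rw [← (ℛ ℂ x).eq]; simp [map_sum]
  have h4 (y : H) : TensorProduct.map LinearMap.id counit (comul y) = y ⊗ₜ[ℂ] (1 : ℂ) :=
    lTensor_counit_comul y
  refine h2.trans ?_
  have h5 := congrArg (TensorProduct.lid ℂ H) (rTensor_counit_comul (R := ℂ) x)
  rw [← (ℛ ℂ x).eq] at h5
  rw [h3, h0]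
  simp only [map_sum, LinearMap.rTensor_tmul, TensorProduct.lid_tmul, one_smul] at h5
  simp [map_sum, h4, h5, ← TensorProduct.tmul_sum, ← TensorProduct.tmul_smul]

theorem mulₗ_apply_one (u : DualCop H ⊗[ℂ] H) : mulₗ H u (1 ⊗ₜ 1) = u := by
  induction u with
  | zero => simp
  | add s t hs ht => simp [hs, ht]
  | tmul α x => simp [mulₗ_tmul, leftMul_apply_one]

theorem mulₗ_one : mulₗ H (1 ⊗ₜ 1) = 1 := by
  simp [mulₗ_tmul, leftMul_one, leftMulDual_one]

end DrinfeldDouble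

/-- The Drinfeld double `D(H) = (H^∨)^cop ⋈ H`: the space `H^∨ ⊗ H`, with the tensor product
coalgebra structure of `(H^∨)^cop` and `H`, and the product `DrinfeldDouble.mulₗ`. -/
def DrinfeldDouble : Type _ := DualCop H ⊗[ℂ] H

namespace DrinfeldDouble

noncomputable instance : AddCommGroup (DrinfeldDouble H) :=
  inferInstanceAs (AddCommGroup (DualCop H ⊗[ℂ] H))

noncomputable instance : Module ℂ (DrinfeldDouble H) :=
  inferInstanceAs (Module ℂ (DualCop H ⊗[ℂ] H))

noncomputable instance : Coalgebra ℂ (DrinfeldDouble H) :=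
  inferInstanceAs (Coalgebra ℂ (DualCop H ⊗[ℂ] H))

variable {H}

/-- The pure tensor `α ⊗ x`, as an element of the double. -/
noncomputable def tmul (α : DualCop H) (x : H) : DrinfeldDouble H := α ⊗ₜ[ℂ] x

noncomputable instance : Ring (DrinfeldDouble H) where
  __ := (inferInstance : AddCommGroup (DrinfeldDouble H))
  mul u v := mulₗ H u v
  one := tmul 1 1
  left_distrib u v w := map_add (mulₗ H u) v w
  right_distrib u v w := LinearMap.map_add₂ (mulₗ H) u v w
  zero_mul v := LinearMap.map_zero₂ (mulₗ H) v
  mul_zero u := map_zero (mulₗ H u)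
  mul_assoc u v w := LinearMap.congr_fun (mulₗ_mulₗ u v) w
  one_mul u := LinearMap.congr_fun mulₗ_one u
  mul_one u := mulₗ_apply_one u

noncomputable instance : Algebra ℂ (DrinfeldDouble H) :=
  Algebra.ofModule (fun c u v => LinearMap.map_smul₂ (mulₗ H) c u v)
    (fun c u v => map_smul (mulₗ H u) c v)

end DrinfeldDouble

end Double

section DoubleHopf

variable {H : Type*} [Ring H] [HopfAlgebra ℂ H] [FiniteDimensional ℂ H] [BijectiveAntipode H]

namespace DrinfeldDouble

theorem toDual₂_map_coreg (p z p' z' : H) (t : DualCop H ⊗[ℂ] DualCop H) (x y : H) :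
    DualCop.toDual₂ H (TensorProduct.map (coreg p z) (coreg p' z') t) (x ⊗ₜ y) =
      DualCop.toDual₂ H t ((z * (x * p)) ⊗ₜ (z' * (y * p'))) := by
  induction t with
  | zero => simp
  | add s t hs ht => simp [hs, ht]
  | tmul α β => simp

theorem comul_coreg (p z : H) (β : DualCop H) :
    comul (R := ℂ) (coreg p z β) =
      TensorProduct.map (coreg p 1) (coreg 1 z) (comul (R := ℂ) β) := by
  apply DualCop.toDual₂_ext
  intro x y
  simp [toDual₂_map_coreg, mul_assoc]

theorem sum_map_coreg (p z : H) (β : DualCop H) {c : H} {ι : Type*} (r : Repr ℂ c ι) :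
    ∑ i ∈ r.index, TensorProduct.map (coreg p (antipodeInv H (r.left i))) (coreg (r.right i) z)
      (comul (R := ℂ) β) =
    counit (R := ℂ) c • TensorProduct.map (coreg p 1) (coreg 1 z) (comul (R := ℂ) β) := by
  apply DualCop.toDual₂_ext
  intro x y
  have h := sum_mul_antipodeInv r
  have h2 := congrArg (fun a => DualCop.toDual H β (z * (y * (a * (x * p))))) h
  simpa [toDual₂_map_coreg, mul_assoc, Finset.sum_mul, Finset.mul_sum, map_sum,
    Algebra.algebraMap_eq_smul_one] using h2

theorem map_trip (p q r p' q' r' : H) (U : DualCop H ⊗[ℂ] DualCop H) (V : H ⊗[ℂ] H) :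
    TensorProduct.map (trip H p q r) (trip H p' q' r')
      (TensorProduct.tensorTensorTensorComm ℂ _ _ _ _ (U ⊗ₜ V)) =
    TensorProduct.tensorTensorTensorComm ℂ _ _ _ _
      (TensorProduct.map (coreg p (antipodeInv H r)) (coreg p' (antipodeInv H r')) U ⊗ₜ
        ((q ⊗ₜ q') * V)) := by
  induction U with
  | zero => simp
  | add s t hs ht => simp [hs, ht, TensorProduct.add_tmul]
  | tmul α β =>
    induction V with
    | zero => simp
    | add s t hs ht => simp [hs, ht, TensorProduct.tmul_add, mul_add]
    | tmul x y => simp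

theorem comul_tmul' (β : DualCop H) (y : H) : comul (R := ℂ) (β ⊗ₜ[ℂ] y) =
    TensorProduct.tensorTensorTensorComm ℂ _ _ _ _
      (comul (R := ℂ) β ⊗ₜ[ℂ] comul (R := ℂ) y) := rfl

/-- Auxiliary map `s ⊗ s' ↦ (B(s) ⊗ B(s')) w`, where `B` is the map that defines `leftMul`. -/
noncomputable def comulAux (w : (DualCop H ⊗[ℂ] H) ⊗[ℂ] (DualCop H ⊗[ℂ] H)) :
    (H ⊗[ℂ] (H ⊗[ℂ] H)) ⊗[ℂ] (H ⊗[ℂ] (H ⊗[ℂ] H)) →ₗ[ℂ]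
      (DualCop H ⊗[ℂ] H) ⊗[ℂ] (DualCop H ⊗[ℂ] H) :=
  LinearMap.applyₗ w ∘ₗ TensorProduct.homTensorHomMap (RingHom.id ℂ) _ _ _ _ ∘ₗ
    TensorProduct.map (uncurry₃ (trip H)) (uncurry₃ (trip H))

@[simp] theorem comulAux_tmul (w : (DualCop H ⊗[ℂ] H) ⊗[ℂ] (DualCop H ⊗[ℂ] H))
    (s s' : H ⊗[ℂ] (H ⊗[ℂ] H)) : comulAux w (s ⊗ₜ s') =
      TensorProduct.map (uncurry₃ (trip H) s) (uncurry₃ (trip H) s') w := rfl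

/-- Auxiliary map `p ⊗ (q ⊗ u) ↦ (p ⊗ (q ⊗ 1)) ⊗ (1 ⊗ u)`. -/
noncomputable def insertOnes : H ⊗[ℂ] (H ⊗[ℂ] (H ⊗[ℂ] H)) →ₗ[ℂ]
    (H ⊗[ℂ] (H ⊗[ℂ] H)) ⊗[ℂ] (H ⊗[ℂ] (H ⊗[ℂ] H)) :=
  TensorProduct.map (TensorProduct.map LinearMap.id ((TensorProduct.mk ℂ H H).flip 1))
    (TensorProduct.mk ℂ H (H ⊗[ℂ] H) 1) ∘ₗ
    (TensorProduct.assoc ℂ H H (H ⊗[ℂ] H)).symm.toLinearMap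

@[simp] theorem insertOnes_tmul (p q : H) (u : H ⊗[ℂ] H) :
    insertOnes (p ⊗ₜ (q ⊗ₜ u)) = (p ⊗ₜ (q ⊗ₜ 1)) ⊗ₜ[ℂ] (1 ⊗ₜ u) := rfl

theorem comul_trip (β : DualCop H) (y : H) :
    comul ∘ₗ LinearMap.applyₗ (β ⊗ₜ[ℂ] y) ∘ₗ uncurry₃ (trip H) =
      comulAux (comul (β ⊗ₜ[ℂ] y)) ∘ₗ insertOnes ∘ₗ TensorProduct.map LinearMap.id
        ((TensorProduct.assoc ℂ H H H).toLinearMap ∘ₗ TensorProduct.map comul LinearMap.id) := by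
  apply TensorProduct.ext
  ext p : 1
  apply TensorProduct.ext'
  intro q r
  simp only [LinearMap.compr₂ₛₗ_apply, TensorProduct.mk_apply, LinearMap.comp_apply,
    TensorProduct.map_tmul, LinearMap.applyₗ_apply_apply, uncurry₃_tmul, trip_apply,
    LinearMap.id_apply, comul_tmul', Bialgebra.comul_mul, comul_coreg]
  rw [← (ℛ ℂ q).eq]
  simp [map_sum, TensorProduct.sum_tmul, TensorProduct.tmul_sum, map_trip, Finset.sum_mul]

theorem comulAux_contract (β : DualCop H) (y : H) :
    comulAux (comul (β ⊗ₜ[ℂ] y)) ∘ₗ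
      ((TensorProduct.assoc ℂ H (H ⊗[ℂ] H) (H ⊗[ℂ] (H ⊗[ℂ] H))).symm.toLinearMap ∘ₗ
        TensorProduct.map LinearMap.id
          ((TensorProduct.assoc ℂ H H (H ⊗[ℂ] (H ⊗[ℂ] H))).symm.toLinearMap ∘ₗ
            TensorProduct.map LinearMap.id ((TensorProduct.assoc ℂ H H (H ⊗[ℂ] H)).toLinearMap ∘ₗ
              TensorProduct.map comul LinearMap.id))) =
    comulAux (comul (β ⊗ₜ[ℂ] y)) ∘ₗ insertOnes ∘ₗ TensorProduct.map LinearMap.id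
      (TensorProduct.map LinearMap.id ((TensorProduct.lid ℂ (H ⊗[ℂ] H)).toLinearMap ∘ₗ
        TensorProduct.map counit LinearMap.id)) := by
  ext p q c q' r
  simp only [TensorProduct.AlgebraTensorModule.curry_apply, LinearMap.restrictScalars_self,
    TensorProduct.curry_apply, LinearMap.comp_apply, TensorProduct.map_tmul, LinearMap.id_apply,
    ← (ℛ ℂ c).eq]
  have h := sum_map_coreg p (antipodeInv H r) β (ℛ ℂ c)
  have h2 := congrArg (fun t => TensorProduct.tensorTensorTensorComm ℂ _ _ _ _
    (t ⊗ₜ[ℂ] ((q ⊗ₜ q') * comul (R := ℂ) y))) h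
  simp only [TensorProduct.sum_tmul, map_sum, ← TensorProduct.smul_tmul', map_smul] at h2
  simp only [map_sum, TensorProduct.sum_tmul, TensorProduct.tmul_sum, LinearEquiv.coe_coe,
    TensorProduct.assoc_tmul, TensorProduct.assoc_symm_tmul, TensorProduct.lid_tmul,
    TensorProduct.tmul_smul, map_smul, insertOnes_tmul, comulAux_tmul, uncurry₃_tmul,
    comul_tmul', map_trip, antipodeInv_one]
  exact h2

theorem comul₃_coassoc :
    TensorProduct.map LinearMap.id
        ((TensorProduct.assoc ℂ H H H).toLinearMap ∘ₗ TensorProduct.map comul LinearMap.id) ∘ₗ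
      (comul₃ H).toLinearMap =
    TensorProduct.map LinearMap.id (TensorProduct.map LinearMap.id comul) ∘ₗ
      (comul₃ H).toLinearMap := by
  simp only [comul₃_toLinearMap, coassoc_simps]

theorem map_comul₃_comul :
    TensorProduct.map (comul₃ H).toLinearMap (comul₃ H).toLinearMap ∘ₗ comul =
    ((TensorProduct.assoc ℂ H (H ⊗[ℂ] H) (H ⊗[ℂ] (H ⊗[ℂ] H))).symm.toLinearMap ∘ₗ
        TensorProduct.map LinearMap.id
          ((TensorProduct.assoc ℂ H H (H ⊗[ℂ] (H ⊗[ℂ] H))).symm.toLinearMap ∘ₗ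
            TensorProduct.map LinearMap.id ((TensorProduct.assoc ℂ H H (H ⊗[ℂ] H)).toLinearMap ∘ₗ
              TensorProduct.map comul LinearMap.id))) ∘ₗ
    TensorProduct.map LinearMap.id
      (TensorProduct.map LinearMap.id (TensorProduct.map LinearMap.id comul ∘ₗ comul)) ∘ₗ
      (comul₃ H).toLinearMap := by
  simp only [comul₃_toLinearMap, coassoc_simps]

theorem lid_counit_comul :
    (TensorProduct.lid ℂ (H ⊗[ℂ] H)).toLinearMap ∘ₗ TensorProduct.map counit LinearMap.id ∘ₗ
      TensorProduct.map LinearMap.id comul ∘ₗ comul = comul (R := ℂ) (A := H) := by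
  ext x
  have h5 := congrArg (TensorProduct.lid ℂ H) (rTensor_counit_comul (R := ℂ) x)
  rw [← (ℛ ℂ x).eq] at h5
  simp only [map_sum, LinearMap.rTensor_tmul, TensorProduct.lid_tmul, one_smul] at h5
  simp only [LinearMap.comp_apply]
  conv_lhs => rw [← (ℛ ℂ x).eq]
  have h6 := congrArg (comul (R := ℂ)) h5
  simp only [map_sum, map_smul] at h6
  simpa using h6

theorem comul_leftMul (x : H) (v : DualCop H ⊗[ℂ] H) :
    comul (leftMul H x v) = TensorProduct.homTensorHomMap (RingHom.id ℂ) _ _ _ _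
      (TensorProduct.map (leftMul H) (leftMul H) (comul x)) (comul v) := by
  induction v with
  | zero => simp
  | add s t hs ht => simp [hs, ht]
  | tmul β y =>
    have h1 := LinearMap.congr_fun (comul_trip β y) (comul₃ H x)
    have h2 := LinearMap.congr_fun (comul₃_coassoc (H := H)) x
    have h3 := LinearMap.congr_fun (map_comul₃_comul (H := H)) x
    have h4 := LinearMap.congr_fun (comulAux_contract β y)
      (TensorProduct.map LinearMap.id (TensorProduct.map LinearMap.id
        (TensorProduct.map LinearMap.id comul ∘ₗ comul)) (comul₃ H x))
    have h5 : TensorProduct.map (leftMul H) (leftMul H) =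
      TensorProduct.map (uncurry₃ (trip H)) (uncurry₃ (trip H)) ∘ₗ
        TensorProduct.map (comul₃ H).toLinearMap (comul₃ H).toLinearMap := by
      rw [← TensorProduct.map_comp]; rfl
    have h6 : TensorProduct.map LinearMap.id
      (TensorProduct.map LinearMap.id ((TensorProduct.lid ℂ (H ⊗[ℂ] H)).toLinearMap ∘ₗ
        TensorProduct.map counit LinearMap.id)) ∘ₗ TensorProduct.map LinearMap.id
        (TensorProduct.map LinearMap.id (TensorProduct.map LinearMap.id comul ∘ₗ comul)) =
      TensorProduct.map (LinearMap.id (M := H)) (TensorProduct.map (LinearMap.id (M := H))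
        (comul (R := ℂ) (A := H))) := by
      rw [← TensorProduct.map_comp, ← TensorProduct.map_comp, LinearMap.comp_assoc,
        lid_counit_comul]
      simp
    have h7 := LinearMap.congr_fun h6 (comul₃ H x)
    have h8 : comul (leftMul H x (β ⊗ₜ[ℂ] y)) = (comul ∘ₗ LinearMap.applyₗ (β ⊗ₜ[ℂ] y) ∘ₗ
      uncurry₃ (trip H)) (comul₃ H x) := rfl
    have h9 : TensorProduct.homTensorHomMap (RingHom.id ℂ) _ _ _ _
        (TensorProduct.map (leftMul H) (leftMul H) (comul x)) (comul (β ⊗ₜ[ℂ] y)) =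
        comulAux (comul (β ⊗ₜ[ℂ] y)) ((TensorProduct.map (comul₃ H).toLinearMap
          (comul₃ H).toLinearMap ∘ₗ comul) x) := by
      rw [h5]; rfl
    simp only [LinearMap.comp_apply, AlgHom.toLinearMap_apply] at h1 h2 h3 h4 h7 h8 h9
    rw [h8, h9, h1, h3, h2, h4, h7]

theorem comul_leftMulDual (α : DualCop H) (v : DualCop H ⊗[ℂ] H) :
    comul (leftMulDual H α v) = TensorProduct.homTensorHomMap (RingHom.id ℂ) _ _ _ _
      (TensorProduct.map (leftMulDual H) (leftMulDual H) (comul (R := ℂ) α)) (comul v) := by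
  have h : leftMulDual H α v = (α ⊗ₜ 1) * v := rfl
  rw [h, Bialgebra.comul_mul, comul_tmul', Bialgebra.comul_one, Algebra.TensorProduct.one_def,
    ← (ℛ ℂ α).eq]
  generalize comul (R := ℂ) v = w
  simp only [TensorProduct.sum_tmul, map_sum, Finset.sum_mul, LinearMap.sum_apply]
  refine Finset.sum_congr rfl fun i _ => ?_
  induction w with
  | zero => simp
  | add s t hs ht => simp only [mul_add, map_add, hs, ht]
  | tmul a b =>
    rw [TensorProduct.tensorTensorTensorComm_tmul, Algebra.TensorProduct.tmul_mul_tmul]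
    rfl

theorem homTensorHomMap_mul {M : Type*} [AddCommGroup M] [Module ℂ M] (f g f' g' : M →ₗ[ℂ] M)
    (w : M ⊗[ℂ] M) :
    TensorProduct.map (f * f') (g * g') w = TensorProduct.map f g (TensorProduct.map f' g' w) := by
  rw [TensorProduct.map_map]; rfl

theorem comul_mulₗ (u v : DualCop H ⊗[ℂ] H) :
    comul (mulₗ H u v) = TensorProduct.homTensorHomMap (RingHom.id ℂ) _ _ _ _
      (TensorProduct.map (mulₗ H) (mulₗ H) (comul u)) (comul v) := by
  induction u with
  | zero => simp
  | add s t hs ht => simp [hs, ht]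
  | tmul α x =>
    rw [mulₗ_tmul, Module.End.mul_apply, comul_leftMulDual, comul_leftMul, comul_tmul',
      ← (ℛ ℂ α).eq, ← (ℛ ℂ x).eq]
    simp [map_sum, TensorProduct.sum_tmul, TensorProduct.tmul_sum, LinearMap.sum_apply,
      mulₗ_tmul, homTensorHomMap_mul]

theorem counit_leftMul (x : H) (v : DualCop H ⊗[ℂ] H) :
    counit (R := ℂ) (leftMul H x v) = counit (R := ℂ) x * counit (R := ℂ) v := by
  induction v with
  | zero => simp
  | add s t hs ht => simp [hs, ht, mul_add]
  | tmul β y =>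
    have h1 : counit ∘ₗ LinearMap.applyₗ (β ⊗ₜ[ℂ] y) ∘ₗ uncurry₃ (trip H) =
        (counit (R := ℂ) y • DualCop.toDual H β ∘ₗ LinearMap.mul' ℂ H ∘ₗ
          (TensorProduct.comm ℂ H H).toLinearMap ∘ₗ
          TensorProduct.map LinearMap.id (antipodeInv H)) ∘ₗ
        TensorProduct.map LinearMap.id ((TensorProduct.lid ℂ H).toLinearMap ∘ₗ
          TensorProduct.map counit LinearMap.id) := by
      apply TensorProduct.ext
      ext p : 1
      apply TensorProduct.ext'
      intro q r
      simp [DualCop.counit_eq]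
      ring
    have h2 : ((TensorProduct.lid ℂ H).toLinearMap ∘ₗ
        TensorProduct.map counit LinearMap.id) ∘ₗ comul = LinearMap.id (R := ℂ) (M := H) := by
      ext z
      have := congrArg (TensorProduct.lid ℂ H) (rTensor_counit_comul (R := ℂ) z)
      rw [TensorProduct.lid_tmul, one_smul] at this
      exact this
    have h3 : TensorProduct.map LinearMap.id ((TensorProduct.lid ℂ H).toLinearMap ∘ₗ
          TensorProduct.map counit LinearMap.id) (comul₃ H x) = comul (R := ℂ) x := by
      change TensorProduct.map LinearMap.id _ (TensorProduct.map LinearMap.id comul (comul x)) = _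
      rw [TensorProduct.map_map, h2]
      simp
    have h4 := sum_antipodeInv_mul (ℛ ℂ x)
    refine (LinearMap.congr_fun h1 (comul₃ H x)).trans ?_
    rw [LinearMap.comp_apply, h3, ← (ℛ ℂ x).eq]
    simp [map_sum, ← Finset.mul_sum, DualCop.counit_eq]
    rw [← map_sum, h4]
    simp [Algebra.algebraMap_eq_smul_one]
    ring

theorem counit_mulₗ (u v : DualCop H ⊗[ℂ] H) :
    counit (R := ℂ) (mulₗ H u v) = counit (R := ℂ) u * counit (R := ℂ) v := by
  induction u with
  | zero => simp
  | add s t hs ht => simp [hs, ht, add_mul]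
  | tmul α x =>
    have h : leftMulDual H α (leftMul H x v) = (α ⊗ₜ 1) * leftMul H x v := rfl
    rw [mulₗ_tmul, Module.End.mul_apply, h, Bialgebra.counit_mul, counit_leftMul]
    simp only [TensorProduct.counit_tmul, Bialgebra.counit_one, smul_eq_mul]
    ring

theorem mul_def (u v : DrinfeldDouble H) : u * v = mulₗ H u v := rfl

theorem one_def : (1 : DrinfeldDouble H) = tmul 1 1 := rfl

theorem tensorMulAux_zero (t : (DualCop H ⊗[ℂ] H) ⊗[ℂ] (DualCop H ⊗[ℂ] H)) :
    TensorProduct.homTensorHomMap (RingHom.id ℂ) _ _ _ _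
      (TensorProduct.map (mulₗ H) (mulₗ H) 0) t = 0 := by
  simp

theorem tensorMulAux_add (s s' t : (DualCop H ⊗[ℂ] H) ⊗[ℂ] (DualCop H ⊗[ℂ] H)) :
    TensorProduct.homTensorHomMap (RingHom.id ℂ) _ _ _ _
      (TensorProduct.map (mulₗ H) (mulₗ H) (s + s')) t =
    TensorProduct.homTensorHomMap (RingHom.id ℂ) _ _ _ _
      (TensorProduct.map (mulₗ H) (mulₗ H) s) t +
    TensorProduct.homTensorHomMap (RingHom.id ℂ) _ _ _ _
      (TensorProduct.map (mulₗ H) (mulₗ H) s') t := by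
  simp

theorem tensor_mul_eq (s t : DrinfeldDouble H ⊗[ℂ] DrinfeldDouble H) :
    s * t = TensorProduct.homTensorHomMap (RingHom.id ℂ) _ _ _ _
      (TensorProduct.map (mulₗ H) (mulₗ H) s) t := by
  induction s with
  | zero => rw [zero_mul]; exact (tensorMulAux_zero t).symm
  | add s s' hs hs' => rw [add_mul, hs, hs']; exact (tensorMulAux_add s s' t).symm
  | tmul a b =>
    induction t with
    | zero => rw [mul_zero]; exact (map_zero _).symm
    | add t t' ht ht' => rw [mul_add, ht, ht']; exact (map_add _ _ _).symm
    | tmul c d => rw [Algebra.TensorProduct.tmul_mul_tmul]; rfl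

theorem comul_mul (u v : DrinfeldDouble H) :
    comul (R := ℂ) (u * v) = comul (R := ℂ) u * comul (R := ℂ) v := by
  rw [tensor_mul_eq]
  exact comul_mulₗ u v

noncomputable instance : Bialgebra ℂ (DrinfeldDouble H) :=
  Bialgebra.mk' ℂ (DrinfeldDouble H)
    (Bialgebra.counit_one (R := ℂ) (A := DualCop H ⊗[ℂ] H))
    (fun {u v} => counit_mulₗ u v)
    (Bialgebra.comul_one (R := ℂ) (A := DualCop H ⊗[ℂ] H))
    (fun {u v} => comul_mul u v)

/-- The Hopf algebra embedding `x ↦ 1 ⊗ x` of `H` in its double. -/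
noncomputable def incl : H →ₐ[ℂ] DrinfeldDouble H :=
  AlgHom.ofLinearMap (TensorProduct.mk ℂ (DualCop H) H 1) rfl (fun x y => by
    change (1 : DualCop H) ⊗ₜ[ℂ] (x * y) = mulₗ H (1 ⊗ₜ x) (1 ⊗ₜ y)
    rw [← leftMul_apply_one (x * y), leftMul_mul, Module.End.mul_apply, leftMul_apply_one,
      mulₗ_tmul, leftMulDual_one, one_mul])

/-- The Hopf algebra embedding `α ↦ α ⊗ 1` of `(H^∨)^cop` in the double of `H`. -/
noncomputable def inclDual : DualCop H →ₐ[ℂ] DrinfeldDouble H :=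
  AlgHom.ofLinearMap ((TensorProduct.mk ℂ (DualCop H) H).flip 1) rfl (fun α β => by
    change (α * β) ⊗ₜ[ℂ] (1 : H) = mulₗ H (α ⊗ₜ 1) (β ⊗ₜ 1)
    rw [mulₗ_tmul, leftMul_one, mul_one, leftMulDual_tmul])

theorem incl_apply (x : H) : incl x = tmul 1 x := rfl

theorem inclDual_apply (α : DualCop H) : inclDual α = tmul α 1 := rfl

theorem inclDual_mul_incl (α : DualCop H) (x : H) : inclDual α * incl x = tmul α x := by
  change mulₗ H (α ⊗ₜ 1) (1 ⊗ₜ x) = α ⊗ₜ[ℂ] x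
  rw [mulₗ_tmul, leftMul_one, mul_one, leftMulDual_tmul, mul_one]

/-- The antipode of the double: `S(α ⊗ x) = (1 ⊗ S(x)) (S(α) ⊗ 1)`, where `S(α) = α ∘ S⁻¹` is the
antipode of `(H^∨)^cop`. -/
noncomputable instance : HopfAlgebraStruct ℂ (DrinfeldDouble H) where
  antipode := TensorProduct.lift ((LinearMap.mul ℂ (DrinfeldDouble H)).flip.compl₁₂
    (inclDual.toLinearMap ∘ₗ antipode ℂ) (incl.toLinearMap ∘ₗ antipode ℂ))

theorem antipode_tmul (α : DualCop H) (x : H) :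
    antipode ℂ (tmul α x) = incl (antipode ℂ x) * inclDual (antipode ℂ α) := rfl

theorem comul_tmul_repr (α : DualCop H) (x : H) {ι κ : Type*} (r : Repr ℂ α ι) (q : Repr ℂ x κ) :
    comul (R := ℂ) (tmul α x) = ∑ i ∈ r.index, ∑ j ∈ q.index,
      tmul (r.left i) (q.left j) ⊗ₜ[ℂ] tmul (r.right i) (q.right j) := by
  refine (comul_tmul' α x).trans ?_
  rw [← r.eq, ← q.eq]
  simp only [TensorProduct.sum_tmul, TensorProduct.tmul_sum, map_sum,
    TensorProduct.tensorTensorTensorComm_tmul]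
  exact Finset.sum_comm

theorem counit_tmul (α : DualCop H) (x : H) :
    counit (R := ℂ) (tmul α x) = counit (R := ℂ) α * counit (R := ℂ) x := by
  change counit (R := ℂ) (α ⊗ₜ[ℂ] x) = _
  simp [mul_comm]

theorem hom_ext {X : Type*} [AddCommGroup X] [Module ℂ X] {f g : DrinfeldDouble H →ₗ[ℂ] X}
    (h : ∀ α x, f (tmul α x) = g (tmul α x)) : f = g :=
  TensorProduct.ext' h

theorem antipode_left (α : DualCop H) (x : H) :
    LinearMap.mul' ℂ (DrinfeldDouble H) ((antipode ℂ).rTensor (DrinfeldDouble H)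
      (comul (R := ℂ) (tmul α x))) =
    algebraMap ℂ (DrinfeldDouble H) (counit (R := ℂ) (tmul α x)) := by
  have h1 := congrArg inclDual (sum_antipode_mul_eq_smul (ℛ ℂ α))
  have h2 := congrArg incl (sum_antipode_mul_eq_smul (ℛ ℂ x))
  simp only [map_sum, map_mul, map_smul, map_one] at h1 h2
  rw [comul_tmul_repr α x (ℛ ℂ α) (ℛ ℂ x), Finset.sum_comm, counit_tmul,
    Algebra.algebraMap_eq_smul_one]
  simp only [map_sum, LinearMap.rTensor_tmul, LinearMap.mul'_apply, antipode_tmul]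
  simp only [← inclDual_mul_incl, mul_assoc]
  simp only [← Finset.mul_sum, ← mul_assoc (inclDual _) (inclDual _) (incl _), ← Finset.sum_mul,
    h1]
  simp only [smul_mul_assoc, one_mul, mul_smul_comm, ← Finset.smul_sum, h2, smul_smul]

theorem antipode_right (α : DualCop H) (x : H) :
    LinearMap.mul' ℂ (DrinfeldDouble H) ((antipode ℂ).lTensor (DrinfeldDouble H)
      (comul (R := ℂ) (tmul α x))) =
    algebraMap ℂ (DrinfeldDouble H) (counit (R := ℂ) (tmul α x)) := by
  have h1 := congrArg inclDual (sum_mul_antipode_eq_smul (ℛ ℂ α))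
  have h2 := congrArg incl (sum_mul_antipode_eq_smul (ℛ ℂ x))
  simp only [map_sum, map_mul, map_smul, map_one] at h1 h2
  rw [comul_tmul_repr α x (ℛ ℂ α) (ℛ ℂ x), counit_tmul, Algebra.algebraMap_eq_smul_one]
  simp only [map_sum, LinearMap.lTensor_tmul, LinearMap.mul'_apply, antipode_tmul]
  simp only [← inclDual_mul_incl, mul_assoc]
  simp only [← Finset.mul_sum, ← mul_assoc (incl _) (incl _) (inclDual _), ← Finset.sum_mul, h2]
  simp only [smul_mul_assoc, one_mul, mul_smul_comm, ← Finset.smul_sum, h1, smul_smul,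
    mul_comm (counit (R := ℂ) α)]

noncomputable instance : HopfAlgebra ℂ (DrinfeldDouble H) where
  mul_antipode_rTensor_comul := hom_ext antipode_left
  mul_antipode_lTensor_comul := hom_ext antipode_right

end DrinfeldDouble

end DoubleHopf

section DualStar

variable {H : Type*} [Ring H] [HopfAlgebra ℂ H] [StarHopfAlgebra H]

theorem StarHopfAlgebra.star_antipode_star_antipode (x : H) :
    star (antipode ℂ (star (antipode ℂ x))) = x := by
  have := congrArg star (StarHopfAlgebra.antipode_star_antipode (star x))
  simpa using this

namespace DualCop

/-- The involution of the dual: `α^*(x) = conj (α(S(x)^*))`. -/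
noncomputable instance : Star (DualCop H) where
  star α := (toDual H).symm
    { toFun := fun x => star (toDual H α (star (antipode ℂ x)))
      map_add' := by simp
      map_smul' := by simp }

theorem toDual_star (α : DualCop H) (x : H) :
    toDual H (star α) x = star (toDual H α (star (antipode ℂ x))) := by
  simp [star]

theorem comul_star_antipode (x : H) : comul (R := ℂ) (star (antipode ℂ x)) =
    ∑ i ∈ (ℛ ℂ x).index, star (antipode ℂ ((ℛ ℂ x).right i)) ⊗ₜ[ℂ]
      star (antipode ℂ ((ℛ ℂ x).left i)) := by
  rw [StarHopfAlgebra.comul_star, comul_antipode]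
  nth_rewrite 1 [← (ℛ ℂ x).eq]
  simp [map_sum, star_sum]

noncomputable instance : StarRing (DualCop H) where
  star_involutive α := by
    apply toDual_injective'
    intro x
    simp [toDual_star, StarHopfAlgebra.star_antipode_star_antipode]
  star_mul α β := by
    apply toDual_injective'
    intro x
    rw [toDual_star, toDual_mul_repr _ _ (ℛ ℂ x), toDual_mul, comul_star_antipode]
    simp [map_sum, star_sum, toDual_star, mul_comm]
  star_add α β := by
    apply toDual_injective'
    intro x
    simp [toDual_star]

theorem toDual₂_star [FiniteDimensional ℂ H] (t : DualCop H ⊗[ℂ] DualCop H) (x y : H)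
    [StarModule ℂ (DualCop H)] :
    toDual₂ H (star t) (x ⊗ₜ y) =
      star (toDual₂ H t (star (antipode ℂ x) ⊗ₜ star (antipode ℂ y))) := by
  induction t with
  | zero => simp
  | add s t hs ht => simp [hs, ht]
  | tmul α β => simp [toDual_star]

/-- The dual `(H^∨)^cop` of a finite `*`-Hopf algebra is a `*`-Hopf algebra. -/
noncomputable instance [FiniteDimensional ℂ H] : StarHopfAlgebra (DualCop H) where
  star_smul c α := by
    apply toDual_injective'
    intro x
    simp [toDual_star]
  comul_star α := by
    have : StarModule ℂ (DualCop H) := ⟨fun c α => by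
      apply toDual_injective'
      intro x
      simp [toDual_star]⟩
    apply toDual₂_ext
    intro x y
    refine Eq.trans ?_ (toDual₂_star _ x y).symm
    simp [toDual_star, antipode_mul_antidistrib]

end DualCop

end DualStar

section CQG

universe u

/-- A right `H`-comodule structure on `V` (of any dimension). -/
structure RightComodule (H : Type*) [Ring H] [HopfAlgebra ℂ H]
    (V : Type*) [AddCommGroup V] [Module ℂ V] where
  /-- The coaction `v ↦ ∑ v₀ ⊗ v₁`. -/
  coact : V →ₗ[ℂ] V ⊗[ℂ] H
  coassoc : TensorProduct.assoc ℂ V H H ∘ₗ coact.rTensor H ∘ₗ coact = comul.lTensor V ∘ₗ coact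
  counit_coact : counit.lTensor V ∘ₗ coact = (TensorProduct.mk ℂ V ℂ).flip 1

/-- A sesquilinear form, linear in the first variable, is an inner product. -/
structure IsInnerProduct {V : Type*} [AddCommGroup V] [Module ℂ V]
    (B : V →ₗ[ℂ] V →ₗ⋆[ℂ] ℂ) : Prop where
  conj_symm : ∀ u v, star (B u v) = B v u
  pos : ∀ v, v ≠ 0 → 0 < (B v v).re

/-- The form `B = ⟨·,·⟩` is invariant: `∑ ⟨u₀, v⟩ S(u₁) = ∑ ⟨u, v₀⟩ v₁^*`. -/
def RightComodule.IsInvariant {H : Type*} [Ring H] [HopfAlgebra ℂ H] [StarHopfAlgebra H]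
    {V : Type*} [AddCommGroup V] [Module ℂ V] (ρ : RightComodule H V)
    (B : V →ₗ[ℂ] V →ₗ⋆[ℂ] ℂ) : Prop :=
  ∀ u v : V,
    TensorProduct.lid ℂ H (TensorProduct.map (B.flip v) (antipode ℂ) (ρ.coact u)) =
    TensorProduct.lid ℂ H (TensorProduct.map (B u) (starLinearEquiv ℂ (A := H)).toLinearMap
      (ρ.coact v))

/-- A `*`-Hopf algebra is a compact quantum group if every right comodule admits an invariant
inner product. -/
def IsCQG (H : Type u) [Ring H] [HopfAlgebra ℂ H] [StarHopfAlgebra H] : Prop :=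
  ∀ (V : Type u) [AddCommGroup V] [Module ℂ V] (ρ : RightComodule H V),
    ∃ B : V →ₗ[ℂ] V →ₗ⋆[ℂ] ℂ, IsInnerProduct B ∧ ρ.IsInvariant B

/-- A `*`-structure on `D(H)` is induced from those of `H` and `H^∨` if `H` and `(H^∨)^cop` are
sub-`*`-Hopf algebras of `D(H)`. -/
def DrinfeldDouble.IsInducedStar (H : Type*) [Ring H] [HopfAlgebra ℂ H] [FiniteDimensional ℂ H]
    [StarHopfAlgebra H] [StarHopfAlgebra (DrinfeldDouble H)] : Prop :=
  (∀ x : H, star (incl x) = incl (star x)) ∧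
    ∀ α : DualCop H, star (inclDual α) = inclDual (star α)

end CQG

/-! For a finite-dimensional `*`-Hopf algebra, being a CQG is equivalent to having a Haar
functional: a two-sided invariant, real functional `h` with `h(x^* x) > 0` for `x ≠ 0`. Everything
rests on the strong invariance `∑ h(y x₁) S(x₂) = ∑ h(y₁ x) y₂`.

From `h` to invariant inner products (`IsHaar.isCQG`): start with any inner product on the comodule
and average it to `∑ ⟨u₀, v₀⟩ h(v₁^* u₁)`; strong invariance makes the result invariant.

From inner products to `h` (`IsCQG.exists_isHaar`): an invariant inner product `B` on the regular
comodule gives `h(x) = B(x, 1) / B(1, 1)`, whose two-sided invariance and reality follow from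
uniqueness. Positivity is the hard point. If it fails, the hermitian form `h(y^* x)` has an
eigenspace `W ≠ 0` relative to `B` with eigenvalue `c ≤ 0`. Both forms are invariant, so `W` is a
subcomodule, and a suitable basis of any nonzero subcomodule satisfies `∑ wᵢ^* wᵢ = d 1` with `d >
0`. Applying `h` gives a positive number on the right and a sum of terms `c B(wᵢ, wᵢ) ≤ 0` on the
left.

If `H` is a CQG, its Haar functional identifies `H` with its dual, and the element `Λ` with `h(Λ x)
= ε(x)` is a self-adjoint two-sided integral. Evaluation at `Λ` is a Haar functional on `(H^∨)^cop`:
positivity is the Plancherel identity `(α^* α)(Λ) = h(z z^*)`, where `α^* = h(z ·)`. Since `Λ`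
absorbs the factors in `γ(S⁻¹(x₃) Λ x₁)`, the functional `α x ↦ α(Λ) h(x)` is Haar on `D(H)`, which
is therefore a CQG. Conversely, an `H`-comodule is a `D(H)`-comodule through the embedding of `H`,
and an inner product invariant for `D(H)` is invariant for `H`.

The involution on `D(H)` must be `(α x)^* = x^* α^*`. The only case of multiplicativity with content
is `(x β)^* = β^* x^*`, which comes from the inverse commutation rule `straighten_comul₃`. -/

/-! ### Inner products and hermitian forms. -/

section Forms

variable {V : Type*} [AddCommGroup V] [Module ℂ V]

theorem IsInnerProduct.self_ne_zero {B : V →ₗ[ℂ] V →ₗ⋆[ℂ] ℂ} (hB : IsInnerProduct B) {v : V}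
    (hv : v ≠ 0) : B v v ≠ 0 := fun h => by
  have := hB.pos v hv
  simp [h] at this

theorem IsInnerProduct.re_self_nonneg {B : V →ₗ[ℂ] V →ₗ⋆[ℂ] ℂ} (hB : IsInnerProduct B) (v : V) :
    0 ≤ (B v v).re := by
  rcases eq_or_ne v 0 with rfl | hv
  · simp
  · exact (hB.pos v hv).le

/-- The inner product space core of an inner product that is linear in the first variable. -/
@[reducible] noncomputable def IsInnerProduct.core {B : V →ₗ[ℂ] V →ₗ⋆[ℂ] ℂ}
    (hB : IsInnerProduct B) : InnerProductSpace.Core ℂ V where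
  inner x y := B y x
  conj_inner_symm x y := hB.conj_symm x y
  re_inner_nonneg x := hB.re_self_nonneg x
  add_left x y z := by simp
  smul_left x y c := by simp
  definite x h := by
    by_contra hx
    exact hB.self_ne_zero hx h

theorem IsInnerProduct.exists_orthonormal_basis [FiniteDimensional ℂ V]
    {B : V →ₗ[ℂ] V →ₗ⋆[ℂ] ℂ} (hB : IsInnerProduct B) :
    ∃ (n : ℕ) (w : Module.Basis (Fin n) ℂ V), (∀ i j, B (w i) (w j) = if i = j then 1 else 0) ∧
      ∀ v i, w.repr v i = B v (w i) := by
  let : NormedAddCommGroup V := hB.core.toNormedAddCommGroup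
  let : InnerProductSpace ℂ V := InnerProductSpace.ofCore hB.core.toCore
  let b := stdOrthonormalBasis ℂ V
  refine ⟨_, b.toBasis, fun i j => ?_, fun v i => ?_⟩
  · have := orthonormal_iff_ite.mp b.orthonormal j i
    rw [b.coe_toBasis]
    refine Eq.trans this ?_
    simp [eq_comm]
  · rw [b.coe_toBasis_repr_apply, b.repr_apply_apply, b.coe_toBasis]
    rfl

/-- In an orthonormal eigenbasis `⟨x, T x⟩ = ∑ λᵢ |⟨bᵢ, x⟩|²`. If every `λᵢ` were positive, a
nonpositive value would force all coordinates of `x` to vanish. -/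
theorem LinearMap.IsSymmetric.exists_nonpos_eigenvector {E : Type*} [NormedAddCommGroup E]
    [InnerProductSpace ℂ E] [FiniteDimensional ℂ E] {T : E →ₗ[ℂ] E} (hT : T.IsSymmetric)
    {x : E} (hx : x ≠ 0) (h : (inner ℂ x (T x)).re ≤ 0) :
    ∃ (c : ℝ) (y : E), c ≤ 0 ∧ y ≠ 0 ∧ T y = (c : ℂ) • y := by
  by_contra! hc
  let b := hT.eigenvectorBasis rfl
  have hb (i) : T (b i) = (hT.eigenvalues rfl i : ℂ) • b i := hT.apply_eigenvectorBasis rfl i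
  have hpos (i) : 0 < hT.eigenvalues rfl i := by
    by_contra! hi
    exact hc _ (b i) hi (b.orthonormal.ne_zero i) (hb i)
  have hsum : inner ℂ x (T x) = ∑ i, (hT.eigenvalues rfl i : ℂ) *
      (inner ℂ x (b i) * inner ℂ (b i) x) := by
    rw [← b.sum_inner_mul_inner x (T x)]
    refine Finset.sum_congr rfl fun i _ => ?_
    rw [← hT (b i) x, hb, inner_smul_left]
    simp
    ring
  have hterm (i) : ((hT.eigenvalues rfl i : ℂ) * (inner ℂ x (b i) * inner ℂ (b i) x)).re =
      hT.eigenvalues rfl i * ‖inner ℂ (b i) x‖ ^ 2 := by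
    rw [← inner_conj_symm x (b i), ← Complex.normSq_eq_conj_mul_self, ← Complex.ofReal_mul,
      Complex.ofReal_re, Complex.normSq_eq_norm_sq]
  rw [hsum, Complex.re_sum] at h
  simp only [hterm] at h
  have h0 := (Finset.sum_eq_zero_iff_of_nonneg (fun i _ =>
    mul_nonneg (hpos i).le (sq_nonneg ‖inner ℂ (b i) x‖))).mp (le_antisymm h
      (Finset.sum_nonneg fun i _ => mul_nonneg (hpos i).le (sq_nonneg _)))
  apply hx
  rw [← b.sum_repr' x]
  refine Finset.sum_eq_zero fun i hi => ?_
  have := h0 i hi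
  simp [(hpos i).ne'] at this
  simp [this]

/-- A hermitian form that is not positive definite has an eigenvector with nonpositive eigenvalue,
relative to any inner product. -/
theorem IsInnerProduct.exists_nonpos_eigenvector [FiniteDimensional ℂ V]
    {B : V →ₗ[ℂ] V →ₗ⋆[ℂ] ℂ} (hB : IsInnerProduct B) {Q : V →ₗ[ℂ] V →ₗ⋆[ℂ] ℂ}
    (hQ : ∀ u v, star (Q u v) = Q v u) {x : V} (hx : x ≠ 0) (h : (Q x x).re ≤ 0) :
    ∃ (c : ℝ) (y : V), c ≤ 0 ∧ y ≠ 0 ∧ ∀ z, Q y z = c * B y z := by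
  obtain ⟨n, w, hw, hr⟩ := hB.exists_orthonormal_basis
  have hexp (v : V) : v = ∑ i, B v (w i) • w i := by
    conv_lhs => rw [← w.sum_repr v]
    simp only [hr]
  -- The operator that represents `Q` with respect to `B`; it is symmetric because `Q` is hermitian.
  let T : V →ₗ[ℂ] V := ∑ i, (Q.flip (w i)).smulRight (w i)
  have hT (u v : V) : B (T u) v = Q u v := by
    conv_rhs => rw [hexp v]
    simp only [T, LinearMap.sum_apply, LinearMap.smulRight_apply, map_sum, map_smul,
      LinearMap.map_smulₛₗ, LinearMap.smul_apply, smul_eq_mul, LinearMap.flip_apply]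
    refine Finset.sum_congr rfl fun i _ => ?_
    rw [← hB.conj_symm v (w i), mul_comm]
    rfl
  let : NormedAddCommGroup V := hB.core.toNormedAddCommGroup
  let : InnerProductSpace ℂ V := InnerProductSpace.ofCore hB.core.toCore
  have hi (u v : V) : inner ℂ u v = B v u := rfl
  have hsymm : T.IsSymmetric := fun u v => by
    rw [hi, hi, hT, ← hB.conj_symm, hT, hQ]
  have h' : (inner ℂ x (T x)).re ≤ 0 := by rw [hi, hT]; exact h
  obtain ⟨c, y, hc, hy, hTy⟩ := hsymm.exists_nonpos_eigenvector hx h'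
  refine ⟨c, y, hc, hy, fun z => ?_⟩
  rw [← hT, hTy]
  simp

/-- A Hamel basis is declared orthonormal, so the dimension of `V` plays no role. This is the form
to be averaged in `IsHaar.isCQG`. -/
theorem exists_isInnerProduct (V : Type*) [AddCommGroup V] [Module ℂ V] :
    ∃ B : V →ₗ[ℂ] V →ₗ⋆[ℂ] ℂ, IsInnerProduct B := by
  let b := Module.Basis.ofVectorSpace ℂ V
  let F : V → V → ℂ := fun u v => (b.repr u).sum fun i a => a * star (b.repr v i)
  have hF (u v : V) (s : Finset _) (hs : (b.repr u).support ⊆ s) :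
      F u v = ∑ i ∈ s, b.repr u i * star (b.repr v i) :=
    Finsupp.sum_of_support_subset _ hs _ (by simp)
  classical
  refine ⟨LinearMap.mk₂'ₛₗ (RingHom.id ℂ) (starRingEnd ℂ) F (fun u u' v => ?_) (fun c u v => ?_)
    (fun u v v' => ?_) (fun c u v => ?_), ⟨fun u v => ?_, fun v hv => ?_⟩⟩
  · let s := (b.repr u).support ∪ (b.repr u').support
    rw [hF u v s Finset.subset_union_left, hF u' v s Finset.subset_union_right,
      hF (u + u') v s (by rw [map_add]; exact Finsupp.support_add), ← Finset.sum_add_distrib]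
    simp [add_mul]
  · rw [hF (c • u) v (b.repr u).support (by rw [map_smul]; exact Finsupp.support_smul),
      hF u v _ subset_rfl]
    simp [Finset.mul_sum, mul_assoc]
  · simp [F, Finsupp.sum, mul_add, Finset.sum_add_distrib]
  · simp [F, Finsupp.sum, Finset.mul_sum, mul_left_comm]
  · let s := (b.repr u).support ∪ (b.repr v).support
    simp only [LinearMap.mk₂'ₛₗ_apply]
    rw [hF u v s Finset.subset_union_left, hF v u s Finset.subset_union_right]
    simp [mul_comm]
  · simp only [LinearMap.mk₂'ₛₗ_apply, F, Finsupp.sum, Complex.re_sum]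
    have hv' : b.repr v ≠ 0 := by simpa using hv
    refine Finset.sum_pos (fun i hi => ?_) (Finsupp.support_nonempty_iff.mpr hv')
    have : b.repr v i * star (b.repr v i) = (Complex.normSq (b.repr v i) : ℂ) :=
      Complex.mul_conj _
    rw [this, Complex.ofReal_re]
    exact Complex.normSq_pos.mpr (by simpa using hi)

end Forms

/-! ### Invariant functionals, and Haar functionals give compact quantum groups. -/

section Haar

variable {K : Type*} [Ring K] [HopfAlgebra ℂ K]

/-- Left invariance of a functional: `∑ h(x₁) x₂ = h(x) 1`. -/
def IsLeftInvariant (h : K →ₗ[ℂ] ℂ) : Prop :=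
  ∀ x, TensorProduct.lid ℂ K (h.rTensor K (comul x)) = h x • (1 : K)

/-- Right invariance of a functional: `∑ x₁ h(x₂) = h(x) 1`. -/
def IsRightInvariant (h : K →ₗ[ℂ] ℂ) : Prop :=
  ∀ x, TensorProduct.rid ℂ K (h.lTensor K (comul x)) = h x • (1 : K)

theorem IsLeftInvariant.sum_smul {h : K →ₗ[ℂ] ℂ} (hh : IsLeftInvariant h) {x : K} {ι : Type*}
    (r : Repr ℂ x ι) : ∑ i ∈ r.index, h (r.left i) • r.right i = h x • (1 : K) := by
  rw [← hh x, ← r.eq]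
  simp [map_sum]

theorem IsRightInvariant.sum_smul {h : K →ₗ[ℂ] ℂ} (hh : IsRightInvariant h) {x : K} {ι : Type*}
    (r : Repr ℂ x ι) : ∑ i ∈ r.index, h (r.right i) • r.left i = h x • (1 : K) := by
  rw [← hh x, ← r.eq]
  simp [map_sum]

theorem isLeftInvariant_of_sum {h : K →ₗ[ℂ] ℂ}
    (hh : ∀ x, ∑ i ∈ (ℛ ℂ x).index, h ((ℛ ℂ x).left i) • (ℛ ℂ x).right i = h x • (1 : K)) :
    IsLeftInvariant h := fun x => by
  rw [← hh x]
  nth_rewrite 1 [← (ℛ ℂ x).eq]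
  simp [map_sum]

theorem isRightInvariant_of_sum {h : K →ₗ[ℂ] ℂ}
    (hh : ∀ x, ∑ i ∈ (ℛ ℂ x).index, h ((ℛ ℂ x).right i) • (ℛ ℂ x).left i = h x • (1 : K)) :
    IsRightInvariant h := fun x => by
  rw [← hh x]
  nth_rewrite 1 [← (ℛ ℂ x).eq]
  simp [map_sum]

/-- Evaluating `∑ f(x₁) g(x₂)` by the invariance of `f` gives `f(x)`, by that of `g` it gives
`g(x)`. -/
theorem IsLeftInvariant.eq_of_isRightInvariant {f g : K →ₗ[ℂ] ℂ} (hf : IsLeftInvariant f)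
    (hg : IsRightInvariant g) (hf1 : f 1 = 1) (hg1 : g 1 = 1) : f = g := by
  ext x
  have h1 := congrArg g (hf.sum_smul (ℛ ℂ x))
  have h2 := congrArg f (hg.sum_smul (ℛ ℂ x))
  simp only [map_sum, map_smul, smul_eq_mul, hf1, hg1, mul_one] at h1 h2
  rw [← h1, ← h2]
  exact Finset.sum_congr rfl fun i _ => mul_comm _ _

theorem IsLeftInvariant.comp_antipode {h : K →ₗ[ℂ] ℂ} (hh : IsLeftInvariant h)
    [BijectiveAntipode K] : IsRightInvariant (h ∘ₗ antipode ℂ) :=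
  isRightInvariant_of_sum fun x => by
    apply BijectiveAntipode.bijective.injective
    have h1 := hh (antipode ℂ x)
    rw [comul_antipode, ← (ℛ ℂ x).eq] at h1
    simpa [map_sum] using h1

/-- Strong invariance. Put `g(x) = ∑ h(y₁ x) y₂` and `φ(x) = h(y x) 1`. Left invariance at `y z`
says `g * id = φ` for convolution, and `S` is the convolution inverse of `id`, so `g = φ * S`. -/
theorem IsLeftInvariant.sum_antipode {h : K →ₗ[ℂ] ℂ} (hh : IsLeftInvariant h) {x y : K}
    {ι κ : Type*} (r : Repr ℂ x ι) (q : Repr ℂ y κ) :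
    ∑ i ∈ r.index, h (y * r.left i) • antipode ℂ (r.right i) =
      ∑ j ∈ q.index, h (q.left j * x) • q.right j := by
  let g : K →ₗ[ℂ] K := ∑ j ∈ q.index, (h ∘ₗ LinearMap.mulLeft ℂ (q.left j)).smulRight (q.right j)
  let φ : K →ₗ[ℂ] K := (h ∘ₗ LinearMap.mulLeft ℂ y).smulRight 1
  have h1 : WithConv.toConv g * WithConv.toConv (LinearMap.id (R := ℂ) (M := K)) =
      WithConv.toConv φ := by
    ext z
    have h2 := hh (y * z)
    rw [Bialgebra.comul_mul, ← q.eq, ← (ℛ ℂ z).eq, Finset.sum_mul_sum] at h2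
    rw [(ℛ ℂ z).convMul_apply]
    simp [φ, g, map_sum, Finset.sum_mul] at h2 ⊢
    rw [← h2, Finset.sum_comm]
  have h3 : WithConv.toConv g = WithConv.toConv φ * WithConv.toConv (antipode ℂ (A := K)) := by
    rw [← h1, mul_assoc, LinearMap.id_mul_antipode, mul_one]
  have h4 := LinearMap.congr_fun (congrArg WithConv.ofConv h3) x
  have h5 : (WithConv.toConv φ * WithConv.toConv (antipode ℂ (A := K))) x =
    ∑ i ∈ r.index, h (y * r.left i) • antipode ℂ (r.right i) := by
    rw [r.convMul_apply]
    simp [φ]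
  rw [← h5]
  refine Eq.trans h4.symm ?_
  simp [g]

/-- A functional that is invariant on both sides, real and faithfully positive. -/
structure IsHaar [StarHopfAlgebra K] (h : K →ₗ[ℂ] ℂ) : Prop where
  left : IsLeftInvariant h
  right : IsRightInvariant h
  map_star : ∀ x, h (star x) = star (h x)
  pos : ∀ x, x ≠ 0 → 0 < (h (star x * x)).re

variable [StarHopfAlgebra K]

/-- The coproduct of `x^*`. -/
@[reducible] def reprStar {x : K} {ι : Type*} (r : Repr ℂ x ι) : Repr ℂ (star x) ι where
  index := r.index
  left i := star (r.left i)
  right i := star (r.right i)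
  eq := by
    rw [StarHopfAlgebra.comul_star, ← r.eq, star_sum]
    simp

/-- The form `⟨x, y⟩ = h(y^* x)`. -/
noncomputable def starForm (h : K →ₗ[ℂ] ℂ) : K →ₗ[ℂ] K →ₗ⋆[ℂ] ℂ :=
  LinearMap.mk₂'ₛₗ (RingHom.id ℂ) (starRingEnd ℂ) (fun x y => h (star y * x))
    (by simp [mul_add]) (by simp) (by simp [add_mul]) (by simp)

@[simp] theorem starForm_apply (h : K →ₗ[ℂ] ℂ) (x y : K) : starForm h x y = h (star y * x) := rfl

theorem starForm_conj_symm {h : K →ₗ[ℂ] ℂ} (hh : ∀ x, h (star x) = star (h x)) (x y : K) :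
    star (starForm h x y) = starForm h y x := by
  simp [← hh]

theorem IsHaar.isInnerProduct {h : K →ₗ[ℂ] ℂ} (hh : IsHaar h) : IsInnerProduct (starForm h) :=
  ⟨starForm_conj_symm hh.map_star, hh.pos⟩

theorem RightComodule.isInvariant_iff {V : Type*} [AddCommGroup V] [Module ℂ V]
    (ρ : RightComodule K V) (B : V →ₗ[ℂ] V →ₗ⋆[ℂ] ℂ) {n : ℕ} (p : Fin n → V →ₗ[ℂ] V)
    (e : Fin n → K) (hp : ∀ v, ρ.coact v = ∑ i, p i v ⊗ₜ e i) :
    ρ.IsInvariant B ↔ ∀ u v, ∑ i, B (p i u) v • antipode ℂ (e i) =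
      ∑ i, B u (p i v) • star (e i) := by
  simp [RightComodule.IsInvariant, hp, map_sum]

/-- Averaging: an arbitrary inner product `B` is replaced by `∑ B(u₀, v₀) h(v₁^* u₁)`. In a basis
`e` of `K` that is orthonormal for `h(y^* x)`, this is a sum of squares of the components `p k` of
the coaction. -/
theorem IsHaar.isCQG {K : Type*} [Ring K] [HopfAlgebra ℂ K] [FiniteDimensional ℂ K]
    [StarHopfAlgebra K] {h : K →ₗ[ℂ] ℂ} (hh : IsHaar h) : IsCQG K := by
  intro V _ _ ρ
  obtain ⟨n, e, he, hr⟩ := hh.isInnerProduct.exists_orthonormal_basis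
  obtain ⟨B, hB⟩ := exists_isInnerProduct V
  let p (i : Fin n) : V →ₗ[ℂ] V :=
    (TensorProduct.rid ℂ V).toLinearMap ∘ₗ (e.coord i).lTensor V ∘ₗ ρ.coact
  have hten (t : V ⊗[ℂ] K) :
      t = ∑ i, TensorProduct.rid ℂ V ((e.coord i).lTensor V t) ⊗ₜ[ℂ] e i := by
    induction t with
    | zero => simp
    | add s t hs ht =>
      conv_lhs => rw [hs, ht]
      simp [TensorProduct.add_tmul, Finset.sum_add_distrib]
    | tmul v x =>
      conv_lhs => rw [← e.sum_repr x, TensorProduct.tmul_sum]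
      simp [TensorProduct.smul_tmul]
  have hp (v : V) : ρ.coact v = ∑ i, p i v ⊗ₜ e i := hten _
  -- Coassociativity of the coaction, with the `k`-th coordinate taken in the first of the two
  -- `K`-legs.
  have hpp (v : V) (k : Fin n) : ∑ i, p k (p i v) ⊗ₜ[ℂ] e i =
      ∑ m, ∑ j ∈ (ℛ ℂ (e m)).index, p m v ⊗ₜ[ℂ]
        (e.repr ((ℛ ℂ (e m)).left j) k • (ℛ ℂ (e m)).right j) := by
    have h1 := LinearMap.congr_fun ρ.coassoc v
    simp only [LinearMap.comp_apply, LinearEquiv.coe_coe] at h1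
    have h2 := congrArg (fun t => ((TensorProduct.lid ℂ K).toLinearMap ∘ₗ (e.coord k).rTensor K).lTensor V t) h1
    rw [hp v] at h2
    simp only [map_sum, LinearMap.rTensor_tmul, LinearMap.lTensor_tmul] at h2
    have h3 (w : V) (x : K) : ((TensorProduct.lid ℂ K).toLinearMap ∘ₗ (e.coord k).rTensor K).lTensor V
        (TensorProduct.assoc ℂ V K K (ρ.coact w ⊗ₜ x)) = p k w ⊗ₜ x := by
      simp only [p, LinearMap.comp_apply, LinearEquiv.coe_coe]
      generalize ρ.coact w = t
      induction t with
      | zero => simp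
      | add s t hs ht => simp [TensorProduct.add_tmul, hs, ht]
      | tmul a b => simp [TensorProduct.smul_tmul]
    simp only [h3] at h2
    rw [h2]
    refine Finset.sum_congr rfl fun m _ => ?_
    nth_rewrite 1 [← (ℛ ℂ (e m)).eq]
    simp [map_sum, TensorProduct.tmul_sum]
  let B' : V →ₗ[ℂ] V →ₗ⋆[ℂ] ℂ := ∑ k, (B ∘ₗ p k).compl₂ (p k)
  have hB' (u v : V) : B' u v = ∑ k, B (p k u) (p k v) := by
    simp [B', LinearMap.sum_apply]
  refine ⟨B', ⟨fun u v => ?_, fun v hv => ?_⟩, (ρ.isInvariant_iff B' p e hp).mpr fun u v => ?_⟩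
  · simp [hB', star_sum, hB.conj_symm]
  · rw [hB', Complex.re_sum]
    refine Finset.sum_pos' (fun k _ => hB.re_self_nonneg _) ?_
    -- If no term is positive, then every `p k v` vanishes, so the coaction kills `v`, and the
    -- counit axiom gives `v = 0`.
    by_contra! hc
    have h0 (k) : p k v = 0 := by
      by_contra hk
      exact absurd (hB.pos _ hk) (not_lt.mpr (hc k (Finset.mem_univ k)))
    apply hv
    have h1 := LinearMap.congr_fun ρ.counit_coact v
    simp only [LinearMap.comp_apply, hp, h0, TensorProduct.zero_tmul, Finset.sum_const_zero,
      map_zero] at h1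
    simpa using congrArg (TensorProduct.rid ℂ V) h1.symm
  -- Strong invariance turns the antipode into a star here. The other side, in `hR`, needs only
  -- coassociativity, and the two expressions differ by exchanging the indices `k` and `m`.
  · have hL (k : Fin n) : ∑ i, B (p k (p i u)) (p k v) • antipode ℂ (e i) =
        ∑ m, ∑ j ∈ (ℛ ℂ (e k)).index, B (p m u) (p k v) •
          h (star ((ℛ ℂ (e k)).left j) * e m) • star ((ℛ ℂ (e k)).right j) := by
      have h1 := congrArg (fun t => TensorProduct.lid ℂ K
        (TensorProduct.map (B.flip (p k v)) (antipode ℂ) t)) (hpp u k)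
      simp only [map_sum, TensorProduct.map_tmul, TensorProduct.lid_tmul, LinearMap.flip_apply,
        map_smul, hr, starForm_apply] at h1
      rw [h1]
      refine Finset.sum_congr rfl fun m _ => ?_
      rw [← Finset.smul_sum, ← Finset.smul_sum,
        hh.left.sum_antipode (ℛ ℂ (e m)) (reprStar (ℛ ℂ (e k)))]
    have hR (k : Fin n) : ∑ i, B (p k u) (p k (p i v)) • star (e i) =
        ∑ m, ∑ j ∈ (ℛ ℂ (e m)).index, B (p k u) (p m v) •
          h (star ((ℛ ℂ (e m)).left j) * e k) • star ((ℛ ℂ (e m)).right j) := by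
      have h1 := congrArg (fun t => TensorProduct.lid ℂ K
        (TensorProduct.map (B (p k u)) (starLinearEquiv ℂ (A := K)).toLinearMap t)) (hpp v k)
      simp only [map_sum, TensorProduct.map_tmul, TensorProduct.lid_tmul, hr] at h1
      simp only [LinearEquiv.coe_coe, starLinearEquiv_apply, star_smul, starForm_conj_symm
        hh.map_star] at h1
      exact h1
    simp only [hB', Finset.sum_smul]
    rw [Finset.sum_comm]
    conv_rhs => rw [Finset.sum_comm]
    simp only [hL, hR]
    exact Finset.sum_comm

end Haar

/-! ### The regular comodule: compact quantum groups have a Haar functional. -/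

section Regular

variable {H : Type*} [Ring H] [HopfAlgebra ℂ H]

variable (H) in
/-- The Hopf algebra as a right comodule over itself. -/
noncomputable def RightComodule.regular : RightComodule H H where
  coact := comul
  coassoc := Coalgebra.coassoc
  counit_coact := Coalgebra.lTensor_counit_comp_comul

variable [StarHopfAlgebra H]

theorem RightComodule.IsInvariant.sum_regular {B : H →ₗ[ℂ] H →ₗ⋆[ℂ] ℂ}
    (hB : (RightComodule.regular H).IsInvariant B) {x y : H} {ι κ : Type*}
    (r : Repr ℂ x ι) (q : Repr ℂ y κ) :
    ∑ i ∈ r.index, B (r.left i) y • antipode ℂ (r.right i) =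
      ∑ j ∈ q.index, B x (q.left j) • star (q.right j) := by
  have h := hB x y
  change TensorProduct.lid ℂ H (TensorProduct.map (B.flip y) (antipode ℂ) (comul x)) =
    TensorProduct.lid ℂ H (TensorProduct.map (B x) (starLinearEquiv ℂ (A := H)).toLinearMap
      (comul y)) at h
  rw [← r.eq, ← q.eq] at h
  simpa [map_sum] using h

/-- The normalized Haar functional `⟨x, 1⟩ / ⟨1, 1⟩` of an invariant inner product. -/
theorem exists_invariant_functional {B : H →ₗ[ℂ] H →ₗ⋆[ℂ] ℂ} (hi : IsInnerProduct B)
    (hB : (RightComodule.regular H).IsInvariant B) :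
    ∃ h : H →ₗ[ℂ] ℂ, h 1 = 1 ∧ IsLeftInvariant h ∧ IsRightInvariant h ∧
      ∀ x, h (star x) = star (h x) := by
  have h10 : (1 : H) ≠ 0 := fun h => by
    have := congrArg (counit (R := ℂ)) h
    simp at this
  let h : H →ₗ[ℂ] ℂ := (B 1 1)⁻¹ • B.flip 1
  have h1 : h 1 = 1 := by simp [h, hi.self_ne_zero h10]
  have hl : IsLeftInvariant h := isLeftInvariant_of_sum fun x => by
    -- Invariance of `B` at `y = 1` reads `∑ B(x₁, 1) S(x₂) = B(x, 1) 1`; applying `S⁻¹` gives left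
    -- invariance.
    let q : Repr ℂ (1 : H) Unit :=
      { index := {()}, left := fun _ => 1, right := fun _ => 1
        eq := by simp [Algebra.TensorProduct.one_def] }
    have h2 := congrArg (fun t => (B 1 1)⁻¹ • antipodeInv H t) (hB.sum_regular (ℛ ℂ x) q)
    simpa [q, map_sum, h, Finset.smul_sum, smul_smul] using h2
  -- Uniqueness gives `h = h ∘ S`, and `h ∘ S` is right invariant. Below, uniqueness applied to `x ↦
  -- conj h(x^*)` gives reality.
  have hS := hl.eq_of_isRightInvariant hl.comp_antipode h1 (by simp [h1])
  have hr : IsRightInvariant h := by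
    rw [hS]
    exact hl.comp_antipode
  let g : H →ₗ[ℂ] ℂ :=
    { toFun := fun x => star (h (star x))
      map_add' := by simp
      map_smul' := by simp }
  have hg : IsLeftInvariant g := isLeftInvariant_of_sum fun x => by
    have h2 := congrArg star (hl.sum_smul (reprStar (ℛ ℂ x)))
    simpa [star_sum, g] using h2
  have hgh := hg.eq_of_isRightInvariant hr (by simp [g, h1]) h1
  refine ⟨h, h1, hl, hr, fun x => ?_⟩
  have h3 := congrArg star (LinearMap.congr_fun hgh x)
  simpa [g] using h3

/-- A tensor whose slices lie in a subspace `W` is expanded along a spanning family of `W`. -/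
theorem eq_sum_tmul_of_slices {M N ι : Type*} [AddCommGroup M] [Module ℂ M] [AddCommGroup N]
    [Module ℂ N] [Fintype ι] {W : Submodule ℂ M} (w : ι → M) (f : ι → M →ₗ[ℂ] ℂ)
    (hw : ∀ x ∈ W, ∑ j, f j x • w j = x) {t : M ⊗[ℂ] N}
    (ht : ∀ α : N →ₗ[ℂ] ℂ, TensorProduct.rid ℂ M (α.lTensor M t) ∈ W) :
    t = ∑ j, w j ⊗ₜ TensorProduct.lid ℂ N ((f j).rTensor N t) := by
  let e := Module.Basis.ofVectorSpace ℂ N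
  -- Expansion along a basis of the second factor. The coefficients are slices, hence lie in `W`.
  have hten (s : M ⊗[ℂ] N) : ∃ c : Module.Basis.ofVectorSpaceIndex ℂ N →₀ M,
      (c.sum fun k m => m ⊗ₜ[ℂ] e k) = s ∧
      ∀ k, c k = TensorProduct.rid ℂ M ((e.coord k).lTensor M s) := by
    classical
    induction s with
    | zero => exact ⟨0, by simp⟩
    | add s t hs ht =>
      obtain ⟨c, hc, hc'⟩ := hs
      obtain ⟨d, hd, hd'⟩ := ht
      refine ⟨c + d, ?_, fun k => by simp [hc', hd']⟩
      rw [Finsupp.sum_add_index' (by simp) (by simp [TensorProduct.add_tmul]), hc, hd]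
    | tmul m x =>
      refine ⟨(e.repr x).mapRange (fun a => a • m) (by simp), ?_, fun k => by simp⟩
      rw [Finsupp.sum_mapRange_index (by simp)]
      conv_rhs => rw [← e.linearCombination_repr x]
      simp [Finsupp.linearCombination_apply, Finsupp.sum, TensorProduct.tmul_sum,
        TensorProduct.smul_tmul]
  obtain ⟨c, hc, hc'⟩ := hten t
  have h1 (k) : c k = ∑ j, f j (c k) • w j := (hw _ (by rw [hc']; exact ht _)).symm
  rw [← hc]
  simp only [Finsupp.sum, map_sum, LinearMap.rTensor_tmul, TensorProduct.lid_tmul,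
    TensorProduct.tmul_sum]
  rw [Finset.sum_comm]
  refine Finset.sum_congr rfl fun k _ => ?_
  nth_rewrite 1 [h1 k]
  simp [TensorProduct.sum_tmul, TensorProduct.smul_tmul]

/-- The form `⟨y^*, x^*⟩`. -/
noncomputable def starConj (B : H →ₗ[ℂ] H →ₗ⋆[ℂ] ℂ) : H →ₗ[ℂ] H →ₗ⋆[ℂ] ℂ :=
  LinearMap.mk₂'ₛₗ (RingHom.id ℂ) (starRingEnd ℂ) (fun x y => B (star y) (star x))
    (by simp) (by simp) (by simp) (by simp)

theorem IsInnerProduct.starConj {B : H →ₗ[ℂ] H →ₗ⋆[ℂ] ℂ} (hB : IsInnerProduct B) :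
    IsInnerProduct (starConj B) :=
  ⟨fun u v => hB.conj_symm _ _, fun v hv => hB.pos _ (by simpa using hv)⟩

theorem IsInnerProduct.domRestrict {V : Type*} [AddCommGroup V] [Module ℂ V]
    {B : V →ₗ[ℂ] V →ₗ⋆[ℂ] ℂ} (hB : IsInnerProduct B) (W : Submodule ℂ V) :
    IsInnerProduct ((B ∘ₗ W.subtype).compl₂ W.subtype) :=
  ⟨fun u v => hB.conj_symm _ _, fun v hv => hB.pos _ (by simpa using hv)⟩

/-- The elements of an orthonormal basis of a subcomodule satisfy `∑ wᵢ^* wᵢ = c 1`, `c > 0`. -/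
theorem exists_sum_star_mul_self {B : H →ₗ[ℂ] H →ₗ⋆[ℂ] ℂ} (hi : IsInnerProduct B)
    (hB : (RightComodule.regular H).IsInvariant B) [FiniteDimensional ℂ H] {W : Submodule ℂ H}
    (hW : ∀ x ∈ W, ∀ α : H →ₗ[ℂ] ℂ, TensorProduct.rid ℂ H (α.lTensor H (comul x)) ∈ W)
    (h0 : W ≠ ⊥) :
    ∃ (n : ℕ) (w : Fin n → H) (c : ℂ), (∀ i, w i ∈ W) ∧ 0 < c.re ∧
      ∑ i, star (w i) * w i = c • 1 := by
  -- Orthonormality is imposed on the adjoints, `B(wⱼ^*, wᵢ^*) = δᵢⱼ`, since invariance will be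
  -- applied to the elements `wᵢ^*`.
  obtain ⟨n, b, hb, hr⟩ := (hi.starConj.domRestrict W).exists_orthonormal_basis
  let w (i : Fin n) : H := b i
  let f (i : Fin n) : H →ₗ[ℂ] ℂ := (starConj B).flip (w i)
  have hwW (i) : w i ∈ W := (b i).2
  have hfw (i j) : f j (w i) = if i = j then 1 else 0 := hb i j
  have hf (x) (hx : x ∈ W) : ∑ j, f j x • w j = x := by
    have h1 := congrArg W.subtype (b.sum_repr ⟨x, hx⟩)
    simp only [map_sum, map_smul, hr] at h1
    exact h1
  let u (j i : Fin n) : H := TensorProduct.lid ℂ H ((f j).rTensor H (comul (w i)))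
  have hcomul (i) : ∑ j, w j ⊗ₜ[ℂ] u j i = comul (w i) :=
    (eq_sum_tmul_of_slices w f hf (hW _ (hwW i))).symm
  let r (i : Fin n) : Repr ℂ (w i) (Fin n) :=
    { index := Finset.univ, left := w, right := fun j => u j i, eq := hcomul i }
  have hε (i) : ∑ k, counit (R := ℂ) (w k) • u k i = w i := sum_counit_smul (r i)
  -- Unitarity of the matrix coefficients `Δ(wᵢ) = ∑ wⱼ ⊗ uⱼᵢ`: invariance of `B` at the pair `wₖ^*,
  -- wᵢ^*`, where orthonormality leaves one term on each side.
  have hu (k i : Fin n) : u k i = antipode ℂ (star (u i k)) := by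
    have h1 := hB.sum_regular (reprStar (r k)) (reprStar (r i))
    have h2 (i j) : B (star (w j)) (star (w i)) = f j (w i) := rfl
    simp [r, h2, hfw] at h1
    exact h1.symm
  -- Here `c = ∑ |ε(wₖ)|²`. If it vanished, `wᵢ = ∑ ε(wₖ) uₖᵢ` would be zero for all `i`, so `W`
  -- would be zero. The identity follows by substituting this expansion and `hu`, then the antipode
  -- axiom for `wₖ^*`.
  refine ⟨n, w, ∑ k, counit (R := ℂ) (w k) * star (counit (R := ℂ) (w k)), hwW, ?_, ?_⟩
  · have hns (z : ℂ) : (z * star z).re = Complex.normSq z := by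
      have : z * star z = (Complex.normSq z : ℂ) := Complex.mul_conj _
      rw [this, Complex.ofReal_re]
    rw [Complex.re_sum]
    simp only [hns]
    refine Finset.sum_pos' (fun k _ => Complex.normSq_nonneg _) ?_
    by_contra! hc
    have hz (k) : counit (R := ℂ) (w k) = 0 := by
      by_contra hk
      exact absurd (Complex.normSq_pos.mpr hk) (not_lt.mpr (hc k (Finset.mem_univ k)))
    apply h0
    rw [Submodule.eq_bot_iff]
    intro x hx
    rw [← hf x hx]
    refine Finset.sum_eq_zero fun i _ => ?_
    rw [← hε i]
    simp [hz]
  · calc ∑ i, star (w i) * w i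
        = ∑ k, counit (R := ℂ) (w k) • ∑ i, star (w i) * antipode ℂ (star (u i k)) := by
          simp only [Finset.smul_sum]
          rw [Finset.sum_comm]
          refine Finset.sum_congr rfl fun i _ => ?_
          nth_rewrite 2 [← hε i]
          rw [Finset.mul_sum]
          refine Finset.sum_congr rfl fun k _ => ?_
          rw [mul_smul_comm, ← hu]
      _ = _ := by
          rw [Finset.sum_smul]
          refine Finset.sum_congr rfl fun k _ => ?_
          have h1 := sum_mul_antipode_eq_smul (reprStar (r k))
          simp only [r] at h1
          rw [h1, StarHopfAlgebra.counit_star, smul_smul]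

/-- Only positivity of the invariant functional remains. A nonpositive eigenspace of `h(y^* x)`
relative to `B` would be a subcomodule, where `∑ wᵢ^* wᵢ = d 1` with `d > 0` contradicts the sign.
-/
theorem IsCQG.exists_isHaar {H : Type*} [Ring H] [HopfAlgebra ℂ H] [StarHopfAlgebra H]
    [FiniteDimensional ℂ H] (hH : IsCQG H) :
    ∃ h : H →ₗ[ℂ] ℂ, IsHaar h := by
  obtain ⟨B, hi, hB⟩ := hH H (RightComodule.regular H)
  obtain ⟨h, h1, hl, hr, hs⟩ := exists_invariant_functional hi hB
  refine ⟨h, hl, hr, hs, fun x hx => ?_⟩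
  by_contra! hx'
  obtain ⟨c, y, hc, hy, hyc⟩ :=
    hi.exists_nonpos_eigenvector (starForm_conj_symm hs) hx (by simpa using hx')
  let W : Submodule ℂ H :=
    { carrier := {x | ∀ z, starForm h x z = c * B x z}
      add_mem' := fun {a b} ha hb z => by rw [map_add, map_add, LinearMap.add_apply,
        LinearMap.add_apply, ha, hb, mul_add]
      zero_mem' := fun z => by simp
      smul_mem' := fun a x hx z => by rw [map_smul, map_smul, LinearMap.smul_apply,
        LinearMap.smul_apply, hx, smul_eq_mul, smul_eq_mul, mul_left_comm] }
  -- The forms `h(y^* x)` and `B` obey the same invariance rule, so the eigenvalue equation passes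
  -- from `x` to `∑ x₁ ⊗ S(x₂)`, and `α ∘ S⁻¹` extracts the slice.
  have hW (x) (hx : x ∈ W) (α : H →ₗ[ℂ] ℂ) :
      TensorProduct.rid ℂ H (α.lTensor H (comul x)) ∈ W := fun z => by
    have e1 := hl.sum_antipode (ℛ ℂ x) (reprStar (ℛ ℂ z))
    have e2 := hB.sum_regular (ℛ ℂ x) (ℛ ℂ z)
    have e3 : ∑ i ∈ (ℛ ℂ x).index, h (star z * (ℛ ℂ x).left i) • antipode ℂ ((ℛ ℂ x).right i) =
        (c : ℂ) • ∑ i ∈ (ℛ ℂ x).index, B ((ℛ ℂ x).left i) z • antipode ℂ ((ℛ ℂ x).right i) := by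
      rw [e1, e2, Finset.smul_sum]
      refine Finset.sum_congr rfl fun j _ => ?_
      rw [smul_smul, ← hx, starForm_apply]
    have e4 := congrArg (fun t => α (antipodeInv H t)) e3
    simp only [map_sum, map_smul, antipodeInv_antipode, smul_eq_mul] at e4
    rw [← (ℛ ℂ x).eq]
    simp only [map_sum, LinearMap.lTensor_tmul, TensorProduct.rid_tmul, map_smul,
      LinearMap.sum_apply, LinearMap.smul_apply, starForm_apply, smul_eq_mul]
    simp only [mul_comm (α _)]
    exact e4
  obtain ⟨n, w, d, hw, hd, hsum⟩ := exists_sum_star_mul_self hi hB hW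
    (fun h0 => hy (by simpa [h0] using (show y ∈ W from hyc)))
  have h2 := congrArg (fun t => (h t).re) hsum
  simp only [map_sum, map_smul, h1, smul_eq_mul, mul_one, Complex.re_sum] at h2
  have h3 (i) : (h (star (w i) * w i)).re ≤ 0 := by
    have := hw i (w i)
    rw [starForm_apply] at this
    rw [this, Complex.re_ofReal_mul]
    exact mul_nonpos_of_nonpos_of_nonneg hc (hi.re_self_nonneg _)
  have h4 := Finset.sum_nonpos fun i (_ : i ∈ Finset.univ) => h3 i
  linarith

end Regular

/-! ### The integral of `H` and the Haar functional of the dual. -/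

section Integral

variable {H : Type*} [Ring H] [HopfAlgebra ℂ H]

theorem IsHaar.eq_of_mul_right [StarHopfAlgebra H] {h : H →ₗ[ℂ] ℂ} (hh : IsHaar h) {y z : H}
    (hyz : ∀ x, h (y * x) = h (z * x)) : y = z := by
  by_contra hne
  have h1 := hh.pos (star (y - z)) (by simpa [sub_eq_zero] using hne)
  rw [star_star, sub_mul, map_sub, hyz, sub_self] at h1
  simp at h1

/-- Evaluation at an element of `H`. -/
noncomputable def DualCop.eval (x : H) : DualCop H →ₗ[ℂ] ℂ :=
  LinearMap.applyₗ x ∘ₗ (toDual H).toLinearMap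

@[simp] theorem DualCop.eval_apply (x : H) (α : DualCop H) : eval x α = toDual H α x := rfl

variable [FiniteDimensional ℂ H]

theorem DualCop.toDual_lid_eval (t : DualCop H ⊗[ℂ] DualCop H) (x y : H) :
    toDual H (TensorProduct.lid ℂ _ ((eval x).rTensor _ t)) y = toDual₂ H t (x ⊗ₜ y) := by
  induction t with
  | zero => simp
  | add s t hs ht => simp [hs, ht]
  | tmul α β => simp

theorem DualCop.toDual_rid_eval (t : DualCop H ⊗[ℂ] DualCop H) (x y : H) :
    toDual H (TensorProduct.rid ℂ _ ((eval x).lTensor _ t)) y = toDual₂ H t (y ⊗ₜ x) := by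
  induction t with
  | zero => simp
  | add s t hs ht => simp [hs, ht]
  | tmul α β => simp [mul_comm]

variable [StarHopfAlgebra H]

/-- Faithfulness makes `z ↦ h(z ·)` injective into the dual, and the dimensions agree. -/
theorem IsHaar.exists_eq_mul_right {h : H →ₗ[ℂ] ℂ} (hh : IsHaar h) (α : H →ₗ[ℂ] ℂ) :
    ∃ z, ∀ x, α x = h (z * x) := by
  let F : H →ₗ[ℂ] Module.Dual ℂ H := (LinearMap.mul ℂ H).compr₂ h
  have hF : Function.Injective F := by
    rw [injective_iff_map_eq_zero]
    intro z hz
    by_contra hz0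
    have h1 := hh.pos (star z) (by simpa using hz0)
    have h2 := LinearMap.congr_fun hz (star z)
    simp only [F, LinearMap.compr₂_apply, LinearMap.mul_apply', LinearMap.zero_apply] at h2
    rw [star_star, h2] at h1
    simp at h1
  obtain ⟨z, hz⟩ := (LinearMap.injective_iff_surjective_of_finrank_eq_finrank
    (Subspace.dual_finrank_eq (K := ℂ) (V := H)).symm).mp hF α
  exact ⟨z, fun x => (LinearMap.congr_fun hz x).symm⟩

/-- The two-sided integral dual to a Haar functional. -/
theorem IsHaar.exists_integral {h : H →ₗ[ℂ] ℂ} (hh : IsHaar h) :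
    ∃ Λ : H, h Λ = 1 ∧ (∀ x, Λ * x = counit (R := ℂ) x • Λ) ∧
      (∀ x, x * Λ = counit (R := ℂ) x • Λ) ∧ star Λ = Λ ∧ antipode ℂ Λ = Λ := by
  obtain ⟨Λ, hΛ⟩ := hh.exists_eq_mul_right (counit (R := ℂ))
  have h1 : h Λ = 1 := by simpa using (hΛ 1).symm
  have hr (x : H) : Λ * x = counit (R := ℂ) x • Λ := hh.eq_of_mul_right fun y => by
    rw [mul_assoc, ← hΛ, smul_mul_assoc, map_smul, ← hΛ, Bialgebra.counit_mul, smul_eq_mul]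
  have hl (x : H) : x * star Λ = counit (R := ℂ) x • star Λ := by
    have := congrArg star (hr (star x))
    simpa [StarHopfAlgebra.counit_star] using this
  have h0 : Λ ≠ 0 := fun h0 => by simp [h0] at h1
  -- This is `h(Λ Λ^*) = ε(Λ^*)`. Being nonzero, `ε(Λ)` can be cancelled when `Λ Λ^*` and `Λ S(Λ)`
  -- are each computed in two ways.
  have hpos : 0 < (counit (R := ℂ) (star Λ)).re := by
    have := hh.pos (star Λ) (by simpa using h0)
    rwa [star_star, ← hΛ] at this
  have hreal : counit (R := ℂ) (star Λ) = counit (R := ℂ) Λ := by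
    have : star (h (Λ * star Λ)) = h (Λ * star Λ) := by rw [← hh.map_star]; simp
    rw [← hΛ, StarHopfAlgebra.counit_star, star_star] at this
    rw [StarHopfAlgebra.counit_star, ← this]
  have hne : counit (R := ℂ) Λ ≠ 0 := fun hz => by
    rw [hreal, hz] at hpos
    simp at hpos
  have hstar : star Λ = Λ := by
    have h2 := hl Λ
    rw [hr, hreal] at h2
    exact (smul_right_injective H hne h2).symm
  rw [hstar] at hl
  refine ⟨Λ, h1, hr, hl, hstar, ?_⟩
  have hinv : counit (R := ℂ) (antipodeInv H Λ) = counit (R := ℂ) Λ := by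
    rw [← counit_antipode, antipode_antipodeInv]
  have hS := hr (antipode ℂ Λ)
  have hS' : Λ * antipode ℂ Λ = counit (R := ℂ) Λ • antipode ℂ Λ := by
    have h2 := congrArg (antipode ℂ) (hr (antipodeInv H Λ))
    rw [antipode_mul_antidistrib, antipode_antipodeInv, map_smul] at h2
    rw [h2, hinv]
  rw [hS', counit_antipode] at hS
  exact smul_right_injective H hne hS

/-- The integral of `H` is a Haar functional on `(H^∨)^cop`. -/
theorem DualCop.isHaar_eval {h : H →ₗ[ℂ] ℂ} (hh : IsHaar h) {Λ : H} (h1 : h Λ = 1)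
    (hr : ∀ x, Λ * x = counit (R := ℂ) x • Λ) (hl : ∀ x, x * Λ = counit (R := ℂ) x • Λ)
    (hstar : star Λ = Λ) (hS : antipode ℂ Λ = Λ) : IsHaar (eval Λ) where
  left α := by
    apply toDual_injective'
    intro y
    rw [toDual_lid_eval, toDual₂_comul, hl]
    simp [toDual_one, mul_comm]
  right α := by
    apply toDual_injective'
    intro y
    rw [toDual_rid_eval, toDual₂_comul, hr]
    simp [toDual_one, mul_comm]
  map_star α := by simp [toDual_star, hS, hstar]
  pos α hα := by
    obtain ⟨z, hz⟩ := hh.exists_eq_mul_right (toDual H (star α))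
    have hz0 : z ≠ 0 := by
      rintro rfl
      apply hα
      rw [← star_eq_zero]
      apply toDual_injective'
      intro x
      simp [hz]
    have hα' (x : H) : toDual H α x = star (h (z * star (antipode ℂ x))) := by
      rw [← hz, ← toDual_star, star_star]
    -- Fourier inversion: strong invariance at `x = Λ` and `z₁ Λ = ε(z₁) Λ` give `∑ h(z Λ₁) S(Λ₂) =
    -- z`. Multiplying by `z^*` and applying `h` yields the Plancherel identity `h4`.
    have h2 := hh.left.sum_antipode (y := z) (ℛ ℂ Λ) (ℛ ℂ z)
    have h3 : ∑ i ∈ (ℛ ℂ Λ).index, h (z * (ℛ ℂ Λ).left i) • antipode ℂ ((ℛ ℂ Λ).right i) = z := by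
      rw [h2]
      simp only [hl, map_smul, h1, smul_eq_mul, mul_one]
      exact sum_counit_smul (ℛ ℂ z)
    have h4 : toDual H (star α * α) Λ = h (z * star z) := by
      rw [toDual_mul_repr _ _ (ℛ ℂ Λ)]
      simp only [hz, hα']
      have h5 := congrArg (fun t => h (t * star z)) h3
      simp only [Finset.sum_mul, map_sum, smul_mul_assoc, map_smul, smul_eq_mul] at h5
      rw [← h5]
      refine Finset.sum_congr rfl fun i _ => ?_
      rw [← hh.map_star, star_mul, star_star]
    rw [eval_apply, h4]
    have := hh.pos (star z) (by simpa using hz0)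
    rwa [star_star] at this

end Integral

/-! ### The Haar functional of the double. -/

namespace DrinfeldDouble

theorem counit_comul₃ {H : Type*} [Ring H] [HopfAlgebra ℂ H] (x : H) :
    ((TensorProduct.lid ℂ H).toLinearMap ∘ₗ TensorProduct.map counit
      ((TensorProduct.rid ℂ H).toLinearMap ∘ₗ TensorProduct.map LinearMap.id counit))
      (comul₃ H x) = x := by
  have h3 : comul₃ H x = ∑ i ∈ (ℛ ℂ x).index, (ℛ ℂ x).left i ⊗ₜ comul ((ℛ ℂ x).right i) := by
    change TensorProduct.map LinearMap.id comul (comul x) = _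
    rw [← (ℛ ℂ x).eq]; simp [map_sum]
  have h4 (y : H) : TensorProduct.map LinearMap.id counit (comul y) = y ⊗ₜ[ℂ] (1 : ℂ) :=
    lTensor_counit_comul y
  rw [h3]
  simp [map_sum, h4, sum_counit_smul]

variable {H : Type*} [Ring H] [HopfAlgebra ℂ H] [FiniteDimensional ℂ H]

section

variable [BijectiveAntipode H]

/-- The functional `α x ↦ f(α) h(x)` on the double. -/
noncomputable def prodFunctional (f : DualCop H →ₗ[ℂ] ℂ) (h : H →ₗ[ℂ] ℂ) :
    DrinfeldDouble H →ₗ[ℂ] ℂ :=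
  TensorProduct.lift ((LinearMap.mul ℂ ℂ).compl₁₂ f h)

theorem prodFunctional_tmul (f : DualCop H →ₗ[ℂ] ℂ) (h : H →ₗ[ℂ] ℂ) (α : DualCop H) (x : H) :
    prodFunctional f h (tmul α x) = f α * h x := rfl

/-- Moving `x` past `γ` produces `γ(S⁻¹(x₃) Λ x₁) h(x₂ y)`. The two-sided integral absorbs both
outer factors into counits, so for this functional `x` and `γ` behave as if they commuted. -/
theorem prodFunctional_incl_mul {h : H →ₗ[ℂ] ℂ} {Λ : H}
    (hr : ∀ x, Λ * x = counit (R := ℂ) x • Λ) (hl : ∀ x, x * Λ = counit (R := ℂ) x • Λ)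
    (x : H) (γ : DualCop H) (y : H) :
    prodFunctional (DualCop.eval Λ) h (incl x * tmul γ y) =
      DualCop.toDual H γ Λ * h (x * y) := by
  have h0 (z : H) : counit (R := ℂ) (antipodeInv H z) = counit (R := ℂ) z := by
    rw [← counit_antipode, antipode_antipodeInv]
  let P : DualCop H ⊗[ℂ] H →ₗ[ℂ] ℂ :=
    TensorProduct.lift ((LinearMap.mul ℂ ℂ).compl₁₂ (DualCop.eval Λ) h)
  have h1 : P ∘ₗ LinearMap.applyₗ (γ ⊗ₜ[ℂ] y) ∘ₗ
      uncurry₃ (trip H) = (DualCop.toDual H γ Λ • (h ∘ₗ LinearMap.mulRight ℂ y)) ∘ₗ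
      ((TensorProduct.lid ℂ H).toLinearMap ∘ₗ TensorProduct.map counit
        ((TensorProduct.rid ℂ H).toLinearMap ∘ₗ TensorProduct.map LinearMap.id counit)) := by
    apply TensorProduct.ext
    ext p : 1
    apply TensorProduct.ext'
    intro q r
    have h2 : P (coreg p (antipodeInv H r) γ ⊗ₜ[ℂ] (q * y)) =
        DualCop.toDual H γ (antipodeInv H r * (Λ * p)) * h (q * y) := by
      rw [← toDual_coreg]; rfl
    simp only [LinearMap.compr₂ₛₗ_apply, TensorProduct.mk_apply, LinearMap.comp_apply,
      LinearMap.applyₗ_apply_apply, uncurry₃_tmul, trip_apply]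
    rw [h2, hr, mul_smul_comm, hl, h0]
    simp
    ring
  have h3 := (LinearMap.congr_fun h1 (comul₃ H x)).trans
    (congrArg (DualCop.toDual H γ Λ • (h ∘ₗ LinearMap.mulRight ℂ y)) (counit_comul₃ x))
  have h4 : incl x * tmul γ y = leftMul H x (γ ⊗ₜ y) := by
    change mulₗ H (1 ⊗ₜ x) (γ ⊗ₜ y) = _
    rw [mulₗ_tmul, leftMulDual_one, one_mul]
  rw [h4]
  exact h3

end

variable [StarHopfAlgebra H]

theorem IsInducedStar.star_tmul [StarHopfAlgebra (DrinfeldDouble H)] (hs : IsInducedStar H)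
    (α : DualCop H) (x : H) : star (tmul α x) = incl (star x) * inclDual (star α) := by
  rw [← inclDual_mul_incl, star_mul, hs.1, hs.2]

/-- Invariance is inherited because the coalgebra is a tensor product. Reality and positivity
involve products with an `x ∈ H` on the left, and `prodFunctional_incl_mul` evaluates these as if
the two factors commuted. -/
theorem isHaar_prodFunctional [StarHopfAlgebra (DrinfeldDouble H)] (hs : IsInducedStar H)
    {h : H →ₗ[ℂ] ℂ} (hh : IsHaar h) {Λ : H}
    (hr : ∀ x, Λ * x = counit (R := ℂ) x • Λ) (hl : ∀ x, x * Λ = counit (R := ℂ) x • Λ)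
    (hΛ : IsHaar (DualCop.eval Λ)) : IsHaar (prodFunctional (DualCop.eval Λ) h) where
  left u := by
    revert u
    refine LinearMap.congr_fun (f := (TensorProduct.lid ℂ _).toLinearMap ∘ₗ
      (prodFunctional (DualCop.eval Λ) h).rTensor _ ∘ₗ comul)
      (g := (prodFunctional (DualCop.eval Λ) h).smulRight 1) (hom_ext fun α x => ?_)
    have h1 := congrArg inclDual (hΛ.left.sum_smul (ℛ ℂ α))
    have h2 := congrArg incl (hh.left.sum_smul (ℛ ℂ x))
    simp only [map_sum, map_smul, map_one] at h1 h2
    have h3 := congrArg₂ (· * ·) h1 h2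
    simp only [Finset.sum_mul_sum, smul_mul_smul_comm, inclDual_mul_incl, mul_one] at h3
    simpa [comul_tmul_repr α x (ℛ ℂ α) (ℛ ℂ x), prodFunctional_tmul] using h3
  right u := by
    revert u
    refine LinearMap.congr_fun (f := (TensorProduct.rid ℂ _).toLinearMap ∘ₗ
      (prodFunctional (DualCop.eval Λ) h).lTensor _ ∘ₗ comul)
      (g := (prodFunctional (DualCop.eval Λ) h).smulRight 1) (hom_ext fun α x => ?_)
    have h1 := congrArg inclDual (hΛ.right.sum_smul (ℛ ℂ α))
    have h2 := congrArg incl (hh.right.sum_smul (ℛ ℂ x))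
    simp only [map_sum, map_smul, map_one] at h1 h2
    have h3 := congrArg₂ (· * ·) h1 h2
    simp only [Finset.sum_mul_sum, smul_mul_smul_comm, inclDual_mul_incl, mul_one] at h3
    simpa [comul_tmul_repr α x (ℛ ℂ α) (ℛ ℂ x), prodFunctional_tmul] using h3
  map_star u := by
    induction u using TensorProduct.induction_on with
    | zero =>
      exact (congrArg _ (star_zero _)).trans ((map_zero _).trans
        ((congrArg star (map_zero _)).trans (star_zero _)).symm)
    | add u v hu hv =>
      exact (congrArg _ (star_add _ _)).trans ((map_add _ _ _).trans
        ((congrArg₂ (· + ·) hu hv).trans ((star_add _ _).symm.trans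
          (congrArg star (map_add _ _ _).symm))))
    | tmul α x =>
      change prodFunctional _ h (star (tmul α x)) = star (prodFunctional _ h (tmul α x))
      rw [hs.star_tmul, inclDual_apply, prodFunctional_incl_mul hr hl, prodFunctional_tmul,
        star_mul, mul_one, hh.map_star, ← hΛ.map_star, mul_comm]
      rfl
  pos u hu := by
    obtain ⟨n, e, he, -⟩ := hh.isInnerProduct.exists_orthonormal_basis
    obtain ⟨β, hβ⟩ : ∃ β : Fin n → DualCop H, u = ∑ k, tmul (β k) (e k) := by
      clear hu
      induction u using TensorProduct.induction_on with
      | zero => exact ⟨0, (Finset.sum_eq_zero fun k _ => TensorProduct.zero_tmul _ _).symm⟩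
      | add u v hu hv =>
        obtain ⟨a, ha⟩ := hu
        obtain ⟨b, hb⟩ := hv
        refine ⟨a + b, (congrArg₂ (· + ·) ha hb).trans ?_⟩
        rw [← Finset.sum_add_distrib]
        exact Finset.sum_congr rfl fun k _ => (TensorProduct.add_tmul _ _ _).symm
      | tmul α x =>
        refine ⟨fun k => e.repr x k • α, ?_⟩
        change α ⊗ₜ[ℂ] x = ∑ k, (e.repr x k • α) ⊗ₜ[ℂ] e k
        conv_lhs => rw [← e.sum_repr x, TensorProduct.tmul_sum]
        simp only [TensorProduct.smul_tmul]
    -- The product is `eₖ^* (βₖ^* βₗ) eₗ`, with value `(βₖ^* βₗ)(Λ) h(eₖ^* eₗ)`; orthonormality of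
    -- `e` leaves the diagonal.
    have hterm (k l : Fin n) : prodFunctional (DualCop.eval Λ) h
        (star (tmul (β k) (e k)) * tmul (β l) (e l)) =
        if k = l then DualCop.eval Λ (star (β k) * β k) else 0 := by
      have h1 : star (tmul (β k) (e k)) * tmul (β l) (e l) =
          incl (star (e k)) * tmul (star (β k) * β l) (e l) := by
        rw [hs.star_tmul, ← inclDual_mul_incl (β l), mul_assoc, ← mul_assoc (inclDual _),
          ← map_mul, inclDual_mul_incl]
      have h2 := he l k
      rw [starForm_apply] at h2
      rw [h1, prodFunctional_incl_mul hr hl, h2]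
      rcases eq_or_ne k l with rfl | hkl
      · simp
      · simp [hkl, hkl.symm]
    have hsum : prodFunctional (DualCop.eval Λ) h (star u * u) =
        ∑ k, DualCop.eval Λ (star (β k) * β k) := by
      rw [hβ, star_sum, Finset.sum_mul_sum]
      simp [map_sum, hterm]
    rw [hsum, Complex.re_sum]
    have hnn (k : Fin n) : 0 ≤ (DualCop.eval Λ (star (β k) * β k)).re :=
      hΛ.isInnerProduct.re_self_nonneg (β k)
    refine Finset.sum_pos' (fun k _ => hnn k) ?_
    by_contra! hc
    apply hu
    rw [hβ]
    refine Finset.sum_eq_zero fun k hk => ?_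
    have : β k = 0 := by
      by_contra h0
      exact absurd (hΛ.pos _ h0) (not_lt.mpr (hc k hk))
    rw [this]
    exact TensorProduct.zero_tmul _ _

theorem isCQG_of_isCQG [StarHopfAlgebra (DrinfeldDouble H)] (hs : IsInducedStar H)
    (hH : IsCQG H) : IsCQG (DrinfeldDouble H) := by
  obtain ⟨h, hh⟩ := hH.exists_isHaar
  obtain ⟨Λ, h1, hr, hl, hstar, hS⟩ := hh.exists_integral
  have : FiniteDimensional ℂ (DualCop H) := Module.Finite.equiv (DualCop.toDual H).symm
  have : FiniteDimensional ℂ (DrinfeldDouble H) :=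
    inferInstanceAs (FiniteDimensional ℂ (DualCop H ⊗[ℂ] H))
  exact (isHaar_prodFunctional hs hh hr hl (DualCop.isHaar_eval hh h1 hr hl hstar hS)).isCQG

end DrinfeldDouble

/-! ### Comodules of `H` as comodules of the double. -/

namespace DrinfeldDouble

variable {H : Type*} [Ring H] [HopfAlgebra ℂ H] [FiniteDimensional ℂ H]

section Incl

variable [BijectiveAntipode H]

theorem comul_incl (x : H) : comul (R := ℂ) (incl x) =
    TensorProduct.map incl.toLinearMap incl.toLinearMap (comul (R := ℂ) x) := by
  let r : Repr ℂ (1 : DualCop H) Unit :=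
    { index := {()}, left := fun _ => 1, right := fun _ => 1
      eq := by simp [Algebra.TensorProduct.one_def] }
  rw [incl_apply, comul_tmul_repr 1 x r (ℛ ℂ x)]
  conv_rhs => rw [← (ℛ ℂ x).eq]
  simp [r, map_sum, incl_apply]

theorem comul_inclDual (α : DualCop H) : comul (R := ℂ) (inclDual α) =
    TensorProduct.map inclDual.toLinearMap inclDual.toLinearMap (comul (R := ℂ) α) := by
  let r : Repr ℂ (1 : H) Unit :=
    { index := {()}, left := fun _ => 1, right := fun _ => 1
      eq := by simp [Algebra.TensorProduct.one_def] }
  rw [inclDual_apply, comul_tmul_repr α 1 (ℛ ℂ α) r]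
  conv_rhs => rw [← (ℛ ℂ α).eq]
  simp [r, map_sum, inclDual_apply]

theorem counit_incl (x : H) : counit (R := ℂ) (incl x) = counit (R := ℂ) x := by
  rw [incl_apply, counit_tmul, Bialgebra.counit_one, one_mul]

theorem antipode_incl (x : H) : antipode ℂ (incl x) = incl (antipode ℂ x) := by
  rw [incl_apply, antipode_tmul, antipode_one, map_one, mul_one]

theorem incl_injective : Function.Injective (incl (H := H)) := by
  let P : DualCop H ⊗[ℂ] H →ₗ[ℂ] H := (TensorProduct.lid ℂ H).toLinearMap ∘ₗ counit.rTensor H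
  refine Function.LeftInverse.injective (g := P) fun x => ?_
  change P (1 ⊗ₜ x) = x
  simp [P]

/-- A comodule over `H` is a comodule over the double. -/
noncomputable def extendComodule {V : Type*} [AddCommGroup V] [Module ℂ V]
    (ρ : RightComodule H V) : RightComodule (DrinfeldDouble H) V where
  coact := incl.toLinearMap.lTensor V ∘ₗ ρ.coact
  coassoc := by
    have h1 : (TensorProduct.assoc ℂ V (DrinfeldDouble H) (DrinfeldDouble H)).toLinearMap ∘ₗ
        (incl.toLinearMap.lTensor V ∘ₗ ρ.coact).rTensor (DrinfeldDouble H) ∘ₗ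
        incl.toLinearMap.lTensor V =
        (TensorProduct.map incl.toLinearMap incl.toLinearMap).lTensor V ∘ₗ
        (TensorProduct.assoc ℂ V H H).toLinearMap ∘ₗ ρ.coact.rTensor H := by
      apply TensorProduct.ext'
      intro v x
      simp only [LinearMap.comp_apply, LinearMap.lTensor_tmul, LinearMap.rTensor_tmul]
      generalize ρ.coact v = t
      induction t with
      | zero => simp
      | add s t hs ht => simp only [map_add, TensorProduct.add_tmul, hs, ht]
      | tmul a b => simp
    have h2 : (comul (R := ℂ) (A := DrinfeldDouble H)).lTensor V ∘ₗ
        incl.toLinearMap.lTensor V =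
        (TensorProduct.map incl.toLinearMap incl.toLinearMap).lTensor V ∘ₗ
        (comul (R := ℂ) (A := H)).lTensor V := by
      apply TensorProduct.ext'
      intro v x
      simp [comul_incl]
    rw [← LinearMap.comp_assoc _ _ (comul.lTensor V), h2, LinearMap.comp_assoc, ← ρ.coassoc,
      ← LinearMap.comp_assoc ρ.coact, ← LinearMap.comp_assoc ρ.coact, h1]
    rfl
  counit_coact := by
    rw [← ρ.counit_coact, ← LinearMap.comp_assoc]
    congr 1
    apply TensorProduct.ext'
    intro v x
    simp [counit_incl]

end Incl

variable [StarHopfAlgebra H]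

/-- For an extended comodule both sides of the invariance identity lie in the image of `H`, since
`incl` respects antipode and star. Injectivity of `incl` brings the identity back to `H`. -/
theorem isCQG_of_isCQG_double [StarHopfAlgebra (DrinfeldDouble H)] (hs : IsInducedStar H)
    (hD : IsCQG (DrinfeldDouble H)) : IsCQG H := by
  intro V _ _ ρ
  obtain ⟨B, hi, hB⟩ := hD V (extendComodule ρ)
  refine ⟨B, hi, fun u v => incl_injective ?_⟩
  have h1 (t : V ⊗[ℂ] H) : TensorProduct.lid ℂ _ (TensorProduct.map (B.flip v) (antipode ℂ)
      (incl.toLinearMap.lTensor V t)) =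
      incl (TensorProduct.lid ℂ _ (TensorProduct.map (B.flip v) (antipode ℂ) t)) := by
    induction t with
    | zero => simp
    | add s t hs ht => simp only [map_add, hs, ht]
    | tmul a b => simp [antipode_incl]
  have h2 (t : V ⊗[ℂ] H) : TensorProduct.lid ℂ _ (TensorProduct.map (B u)
      (starLinearEquiv ℂ (A := DrinfeldDouble H)).toLinearMap (incl.toLinearMap.lTensor V t)) =
      incl (TensorProduct.lid ℂ _ (TensorProduct.map (B u)
        (starLinearEquiv ℂ (A := H)).toLinearMap t)) := by
    induction t with
    | zero => simp
    | add s t hs ht => simp only [map_add, hs, ht]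
    | tmul a b => simp [hs.1]
  rw [← h1, ← h2]
  exact hB u v

end DrinfeldDouble

/-! ### The involution of the double. -/

namespace DrinfeldDouble

variable {H : Type*} [Ring H] [HopfAlgebra ℂ H] [FiniteDimensional ℂ H]

section Straightening

variable [BijectiveAntipode H]

theorem incl_mul_inclDual (x : H) (β : DualCop H) :
    incl x * inclDual β = uncurry₃ (trip H) (comul₃ H x) (β ⊗ₜ 1) := by
  change mulₗ H (1 ⊗ₜ x) (β ⊗ₜ 1) = _
  rw [mulₗ_tmul, leftMulDual_one, one_mul]
  rfl

/-- The map `p ⊗ (s ⊗ r) ↦ B(s) (β(r · S⁻¹(p)) ⊗ 1)`, where `B` is the map that defines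
`leftMul`. -/
noncomputable def straightenAux (β : DualCop H) :
    H ⊗[ℂ] ((H ⊗[ℂ] (H ⊗[ℂ] H)) ⊗[ℂ] H) →ₗ[ℂ] DualCop H ⊗[ℂ] H :=
  uncurry₃ (LinearMap.mk₂ ℂ (fun p s => uncurry₃ (trip H) s ∘ₗ
      (TensorProduct.mk ℂ (DualCop H) H).flip 1 ∘ₗ LinearMap.applyₗ β ∘ₗ
      coregₗ H (antipodeInv H p))
    (fun p p' s => by ext : 1; simp)
    (fun c p s => by ext : 1; simp)
    (fun p s s' => by ext : 1; simp)
    (fun c p s => by ext : 1; simp))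

@[simp] theorem straightenAux_tmul (β : DualCop H) (p r : H) (s : H ⊗[ℂ] (H ⊗[ℂ] H)) :
    straightenAux β (p ⊗ₜ (s ⊗ₜ r)) =
      uncurry₃ (trip H) s (coreg (antipodeInv H p) r β ⊗ₜ 1) := rfl

/-- The map `p ⊗ (q ⊗ r) ↦ q · β(r · S⁻¹(p))`. -/
noncomputable def straighten (β : DualCop H) : H ⊗[ℂ] (H ⊗[ℂ] H) →ₗ[ℂ] DualCop H ⊗[ℂ] H :=
  straightenAux β ∘ₗ
    TensorProduct.map LinearMap.id (TensorProduct.map (comul₃ H).toLinearMap LinearMap.id)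

theorem straighten_tmul (β : DualCop H) (p q r : H) :
    straighten β (p ⊗ₜ (q ⊗ₜ r)) = incl q * inclDual (coreg (antipodeInv H p) r β) := by
  rw [incl_mul_inclDual]
  rfl

/-- Both arguments collapse by `∑ x₂ S⁻¹(x₁) = ε(x) 1`. -/
theorem coreg_sum_sum (β : DualCop H) {x z : H} {ι κ : Type*} (r : Repr ℂ x ι) (q : Repr ℂ z κ) :
    ∑ i ∈ r.index, ∑ j ∈ q.index,
      coreg (r.right i * antipodeInv H (r.left i)) (q.right j * antipodeInv H (q.left j)) β =
    (counit (R := ℂ) x * counit (R := ℂ) z) • β := by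
  have h1 := sum_mul_antipodeInv r
  have h2 := sum_mul_antipodeInv q
  simp only [← coregₗ_apply, ← LinearMap.sum_apply, ← map_sum, h1, h2]
  simp [Algebra.algebraMap_eq_smul_one, coreg_one_one, smul_smul, mul_comm]

/-- The elements of the dual move past those of `H` by
`β x = ∑ x₂ (S⁻¹(x₁) ⇀ β ↼ x₃)`. -/
theorem straighten_comul₃ (β : DualCop H) (x : H) : straighten β (comul₃ H x) = β ⊗ₜ x := by
  -- With five legs `x₁, …, x₅`, moving the middle factor past `β` again leaves `β` acted on by `x₂
  -- S⁻¹(x₁)` and `x₅ S⁻¹(x₄)`. Both cancel and only `x₃` survives.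
  have h1 : straightenAux β ∘ₗ (TensorProduct.map LinearMap.id
        ((TensorProduct.assoc ℂ H (H ⊗[ℂ] H) H).symm.toLinearMap ∘ₗ
        TensorProduct.map LinearMap.id (TensorProduct.assoc ℂ H H H).symm.toLinearMap) ∘ₗ
        (TensorProduct.assoc ℂ H H (H ⊗[ℂ] (H ⊗[ℂ] H))).toLinearMap) ∘ₗ
      (TensorProduct.map comul (TensorProduct.map LinearMap.id comul)) =
      TensorProduct.mk ℂ (DualCop H) H β ∘ₗ
      ((TensorProduct.lid ℂ H).toLinearMap ∘ₗ TensorProduct.map counit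
        ((TensorProduct.rid ℂ H).toLinearMap ∘ₗ TensorProduct.map LinearMap.id counit)) := by
    apply TensorProduct.ext
    ext p : 1
    apply TensorProduct.ext'
    intro q r
    have h2 := congrArg (fun t => t ⊗ₜ[ℂ] q) (coreg_sum_sum β (ℛ ℂ p) (ℛ ℂ r))
    simp only [LinearMap.compr₂ₛₗ_apply, TensorProduct.mk_apply, LinearMap.comp_apply,
      TensorProduct.map_tmul, LinearMap.id_apply]
    conv_lhs => rw [← (ℛ ℂ p).eq, ← (ℛ ℂ r).eq]
    simp only [TensorProduct.sum_tmul, TensorProduct.tmul_sum, map_sum] at h2 ⊢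
    rw [Finset.sum_comm] at h2
    simp only [LinearEquiv.coe_coe, TensorProduct.assoc_tmul, TensorProduct.assoc_symm_tmul,
      TensorProduct.map_tmul, LinearMap.id_apply, LinearMap.comp_apply, straightenAux_tmul,
      uncurry₃_tmul, trip_apply, coreg_coreg, mul_one, h2]
    simp [TensorProduct.smul_tmul, smul_smul, mul_comm]
  exact (congrArg (straightenAux β) (LinearMap.congr_fun (comul₃_comul₃ (H := H)) x)).trans
    ((LinearMap.congr_fun h1 (comul₃ H x)).trans
      (congrArg (TensorProduct.mk ℂ (DualCop H) H β) (counit_comul₃ x)))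

end Straightening

variable [StarHopfAlgebra H]

/-- The star of the dual involves `y ↦ S(y)^*`, which preserves products and sends `S⁻¹(p^*)` to `p`
and `r^*` to `S⁻¹(r)`. The star thus turns the action in the product rule into the one in
`straighten`. -/
theorem star_coreg (p r : H) (β : DualCop H) :
    star (coreg p (antipodeInv H r) β) = coreg (antipodeInv H (star p)) (star r) (star β) := by
  apply DualCop.toDual_injective'
  intro y
  have h1 : star (antipode ℂ (star r)) = antipodeInv H r := by
    apply BijectiveAntipode.bijective.injective
    rw [StarHopfAlgebra.antipode_star_antipode, antipode_antipodeInv]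
  rw [DualCop.toDual_star, toDual_coreg, toDual_coreg, DualCop.toDual_star]
  simp [antipode_mul_antidistrib, h1, mul_assoc]

theorem comul₃_star {H : Type*} [Ring H] [HopfAlgebra ℂ H] [StarHopfAlgebra H] (x : H) : comul₃ H (star x) = star (comul₃ H x) := by
  have h3 (y : H) {ι : Type _} (r : Repr ℂ y ι) :
      comul₃ H y = ∑ i ∈ r.index, r.left i ⊗ₜ comul (r.right i) := by
    change TensorProduct.map LinearMap.id comul (comul y) = _
    rw [← r.eq]; simp [map_sum]
  rw [h3 _ (reprStar (ℛ ℂ x)), h3 _ (ℛ ℂ x), star_sum]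
  simp [StarHopfAlgebra.comul_star]

/-- The involution `(α x)^* = x^* α^*` of the double, as an additive map. -/
noncomputable def starHom : DrinfeldDouble H →+ DrinfeldDouble H :=
  (TensorProduct.lift ((LinearMap.mul ℂ (DrinfeldDouble H)).flip.compl₁₂
    inclDual.toLinearMap incl.toLinearMap) :
      DualCop H ⊗[ℂ] H →ₗ[ℂ] DrinfeldDouble H).toAddMonoidHom.comp
    (starAddEquiv (R := DualCop H ⊗[ℂ] H)).toAddMonoidHom

theorem starHom_tmul (α : DualCop H) (x : H) :
    starHom (tmul α x) = incl (star x) * inclDual (star α) := rfl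

theorem induction_on {P : DrinfeldDouble H → Prop} (u : DrinfeldDouble H)
    (h : ∀ α x, P (tmul α x)) (hadd : ∀ u v, P u → P v → P (u + v)) : P u := by
  induction u using TensorProduct.induction_on with
  | zero =>
    have := h 0 0
    rwa [tmul, TensorProduct.zero_tmul] at this
  | add u v hu hv => exact hadd u v hu hv
  | tmul α x => exact h α x

theorem starHom_smul (c : ℂ) (u : DrinfeldDouble H) : starHom (c • u) = star c • starHom u := by
  induction u using induction_on with
  | hadd u v hu hv => rw [smul_add, map_add, map_add, hu, hv, smul_add]
  | h α x =>
    change starHom (tmul (c • α) x) = star c • starHom (tmul α x)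
    rw [starHom_tmul, starHom_tmul, star_smul, map_smul, mul_smul_comm]

/-- This is `(x β)^* = β^* x^*`, the compatibility of the star with the commutation rule. Expanding
`x β` and starring each term gives `straighten (star β)` at `Δ₃(x^*)`, and `straighten_comul₃` sums
it. -/
theorem starHom_incl_mul_inclDual (x : H) (β : DualCop H) :
    starHom (incl x * inclDual β) = tmul (star β) (star x) := by
  have h1 (t : H ⊗[ℂ] (H ⊗[ℂ] H)) :
      starHom (uncurry₃ (trip H) t (β ⊗ₜ 1)) = straighten (star β) (star t) := by
    have hz : starHom ((0 : DualCop H ⊗[ℂ] H)) = (0 : DualCop H ⊗[ℂ] H) := map_zero starHom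
    have ha (u v : DualCop H ⊗[ℂ] H) : starHom (u + v : DualCop H ⊗[ℂ] H) =
        (starHom u + starHom v : DualCop H ⊗[ℂ] H) := map_add starHom u v
    induction t with
    | zero => simpa using hz
    | add s t hs ht =>
      rw [map_add, LinearMap.add_apply, ha, hs, ht, star_add, map_add]
      rfl
    | tmul p s =>
      induction s with
      | zero => simpa using hz
      | add s t hs ht =>
        rw [TensorProduct.tmul_add, map_add, LinearMap.add_apply, ha, hs, ht, star_add, map_add]
        rfl
      | tmul q r =>
        rw [TensorProduct.star_tmul, TensorProduct.star_tmul, straighten_tmul, ← star_coreg,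
          uncurry₃_tmul, trip_apply, mul_one]
        exact starHom_tmul _ _
  rw [incl_mul_inclDual, h1, ← comul₃_star, straighten_comul₃]
  rfl

theorem starHom_inclDual_mul (α : DualCop H) (u : DrinfeldDouble H) :
    starHom (inclDual α * u) = starHom u * inclDual (star α) := by
  induction u using induction_on with
  | h β x =>
    rw [← inclDual_mul_incl β, ← mul_assoc, ← map_mul, inclDual_mul_incl, inclDual_mul_incl,
      starHom_tmul, starHom_tmul, star_mul, map_mul, mul_assoc]
  | hadd u v hu hv => rw [mul_add, map_add, map_add, hu, hv, add_mul]

theorem starHom_mul_incl (u : DrinfeldDouble H) (x : H) :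
    starHom (u * incl x) = incl (star x) * starHom u := by
  induction u using induction_on with
  | h β y =>
    rw [← inclDual_mul_incl β, mul_assoc, ← map_mul, inclDual_mul_incl, inclDual_mul_incl,
      starHom_tmul, starHom_tmul, star_mul, map_mul, mul_assoc]
  | hadd u v hu hv => rw [add_mul, map_add, map_add, hu, hv, mul_add]

/-- In `α x β y` the outer factors `α` and `y` come out directly, leaving the middle product `x β`,
which is `starHom_incl_mul_inclDual`. -/
theorem starHom_mul (u v : DrinfeldDouble H) : starHom (u * v) = starHom v * starHom u := by
  induction u using induction_on with
  | hadd u u' hu hu' => rw [add_mul, map_add, map_add, hu, hu', mul_add]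
  | h α x =>
    induction v using induction_on with
    | hadd v v' hv hv' => rw [mul_add, map_add, map_add, hv, hv', add_mul]
    | h β y =>
      rw [← inclDual_mul_incl, ← inclDual_mul_incl, mul_assoc, ← mul_assoc (incl x),
        starHom_inclDual_mul, starHom_mul_incl, starHom_incl_mul_inclDual, inclDual_mul_incl,
        inclDual_mul_incl, starHom_tmul, starHom_tmul, ← inclDual_mul_incl]
      simp only [mul_assoc]

theorem starHom_starHom (u : DrinfeldDouble H) : starHom (starHom u) = u := by
  induction u using induction_on with
  | h α x => rw [starHom_tmul, starHom_incl_mul_inclDual, star_star, star_star]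
  | hadd u v hu hv => rw [map_add, map_add, hu, hv]

theorem starHom_incl (x : H) : starHom (incl x) = incl (star x) := by
  rw [incl_apply, starHom_tmul, star_one, map_one, mul_one]

theorem starHom_inclDual (α : DualCop H) : starHom (inclDual α) = inclDual (star α) := by
  rw [inclDual_apply, starHom_tmul, star_one, map_one, one_mul]

variable (H) in
/-- The double as a `*`-ring. -/
@[reducible] noncomputable def starRing : StarRing (DrinfeldDouble H) where
  star := starHom
  star_involutive := starHom_starHom
  star_mul := starHom_mul
  star_add := map_add starHom

variable (H) in
/-- The double as a `*`-Hopf algebra. -/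
@[reducible] noncomputable def starHopfAlgebra : StarHopfAlgebra (DrinfeldDouble H) :=
  letI := starRing H
  haveI : StarModule ℂ (DrinfeldDouble H) := ⟨starHom_smul⟩
  { comul_star := fun u => by
      have hx (x : H) : comul (R := ℂ) (incl (star x)) = star (comul (R := ℂ) (incl x)) := by
        rw [comul_incl, comul_incl, ← (reprStar (ℛ ℂ x)).eq, ← (ℛ ℂ x).eq]
        simp only [map_sum, star_sum, TensorProduct.map_tmul, TensorProduct.star_tmul,
          AlgHom.toLinearMap_apply]
        exact Finset.sum_congr rfl fun i _ => congrArg₂ _ (starHom_incl _).symm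
          (starHom_incl _).symm
      have hα (α : DualCop H) :
          comul (R := ℂ) (inclDual (star α)) = star (comul (R := ℂ) (inclDual α)) := by
        rw [comul_inclDual, comul_inclDual, ← (reprStar (ℛ ℂ α)).eq, ← (ℛ ℂ α).eq]
        simp only [map_sum, star_sum, TensorProduct.map_tmul, TensorProduct.star_tmul,
          AlgHom.toLinearMap_apply]
        exact Finset.sum_congr rfl fun i _ => congrArg₂ _ (starHom_inclDual _).symm
          (starHom_inclDual _).symm
      -- The coproduct is multiplicative and `*`-compatible on both subalgebras, and the star of the
      -- tensor square reverses products, so the claim follows for `α x`.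
      change comul (starHom u) = star (comul u)
      induction u using induction_on with
      | h α x =>
        rw [starHom_tmul, ← inclDual_mul_incl, Bialgebra.comul_mul, Bialgebra.comul_mul, hx, hα,
          star_mul]
      | hadd u v hu hv => rw [map_add, map_add, map_add, hu, hv, star_add] }

end DrinfeldDouble

/-- By `IsInducedStar.star_tmul` an induced involution is determined on the elements `α x`, which
span, so the second clause concerns the same involution as the one constructed. -/
theorem mainTheorem3 (H : Type*) [Ring H] [HopfAlgebra ℂ H] [FiniteDimensional ℂ H]
    [StarHopfAlgebra H] :
    (∃ _ : StarHopfAlgebra (DrinfeldDouble H), DrinfeldDouble.IsInducedStar H) ∧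
    ∀ _ : StarHopfAlgebra (DrinfeldDouble H), DrinfeldDouble.IsInducedStar H →
      (IsCQG H ↔ IsCQG (DrinfeldDouble H)) :=
  ⟨⟨DrinfeldDouble.starHopfAlgebra H, DrinfeldDouble.starHom_incl,
    DrinfeldDouble.starHom_inclDual⟩, fun _ hs =>
    ⟨DrinfeldDouble.isCQG_of_isCQG hs, DrinfeldDouble.isCQG_of_isCQG_double hs⟩⟩
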